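/- **Conventions.** Manifolds are smooth, finite-dimensional, Hausdorff and $\sigma$-compact; vector bundles are smooth and real, of constant finite rank. A *double vector bundle* $(\mathbb E;Q,B;M)$ is a smooth manifold $\mathbb E$ with two vector bundle structures $\pi_Q\colon\mathbb E\to Q$ (operations $+_Q$, $\cdot_Q$) and $\pi_B\colon\mathbb E\to B$ (operations $+_B$, $\cdot_B$) over the total spaces of two vector bundles $q_Q\colon Q\to M$ and $q_B\colon B\to M$ such that $q_Q\circ\pi_Q=q_B\circ\pi_B$, and such that $\pi_B$ is a vector bundle morphism over $q_Q$, the addition $+_B\colon\mathbb E\times_B\mathbb E\to\mathbb E$ is a vector bundle morphism over the addition of $Q$, and each scalar multiplication $t\cdot_B$ is a vector bundle morphism over the scalar multiplication by $t$ of $Q$. Its *core* is the set of the elements that project to zero vectors in both $Q$ and $B$. A *linear metric* on $\mathbb E$ is a smooth symmetric non-degenerate bilinear pairing $\langle\cdot,\cdot\rangle\colon\mathbb E\times_B\mathbb E\to\mathbb R$ of the vector bundle $\mathbb E\to B$ that is linear over $Q$: $\langle e_1+_Qe_2,f_1+_Qf_2\rangle=\langle e_1,f_1\rangle+\langle e_2,f_2\rangle$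 and $\langle t\cdot_Qe_1,t\cdot_Qf_1\rangle=t\langle e_1,f_1\rangle$ whenever these are defined. A double vector bundle with a linear metric is a *metric double vector bundle*; its core is then identified with $Q^*$, the core element $\overline\tau$ of $\tau\in Q^*_m$ being the one over $m$ with $\langle 0_q,\overline\tau\rangle=\tau(q)$ for all $q\in Q_m$, where $0_q$ is the zero of the fibre $\pi_Q^{-1}(q)$. A *linear splitting* is an injective morphism of double vector bundles $\Sigma\colon Q\times_MB\to\mathbb E$ over the identities of $Q$ and $B$; it is *Lagrangian* if its image is maximal isotropic in each fibre of $\mathbb E\to B$. Two linear splittings $\Sigma_1,\Sigma_2$ *differ by* the section $\phi$ of $Q^*\otimes Q^*\otimes B^*$ if $$\Sigma_1(q,b)-_B\Sigma_2(q,b)=0_b+_Q\overline{\phi(q,\cdot)(b)}\qquad\text{for all }(q,b)\in Q\times_MB,$$ where $0_b$ is the zero of the fibre $\pi_B^{-1}(b)$ and $\phi(q,\cdot)(b)\in Q^*$ is $q'\mapsto\phi(q,q')(b)$. **Proposition.** Let $(\mathbb E;Q,B;M)$ be a metric double vector bundle. 1. $\mathbb E$ admits a Lagrangian linear splitting. 2.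 For every linear splitting $\Sigma$ of $\mathbb E$ there is a smooth section $\Lambda$ of $Q^*\otimes Q^*\otimes B^*$, symmetric in its two $Q$-arguments, with $\langle\Sigma(q_1,b),\Sigma(q_2,b)\rangle=\Lambda(q_1,q_2)(b)$ for all $m\in M$, $q_1,q_2\in Q_m$, $b\in B_m$, and there is a Lagrangian linear splitting $\Sigma'$ such that $\Sigma$ and $\Sigma'$ differ by $\tfrac12\Lambda$. 3. Let $\Sigma_1$ be a Lagrangian linear splitting and $\Sigma_2$ any linear splitting of $\mathbb E$. Then $\Sigma_1$ and $\Sigma_2$ differ by a smooth section $\phi$ of $Q^*\otimes Q^*\otimes B^*$, and $\Sigma_2$ is Lagrangian if and only if $\phi(q,q')=-\phi(q',q)$ for all $(q,q')\in Q\times_MQ$, i.e. if and only if $\phi$ is a section of $(Q^*\wedge Q^*)\otimes B^*$. -/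

import Mathlib

open Bundle Manifold
open scoped ContDiff

noncomputable section

namespace DVB

/-! ### Fibrewise operations on the total space of a vector bundle -/

section FibreOperations

variable {N F : Type*} {E : N → Type*} [∀ x, AddCommGroup (E x)]

open Classical in
/-- Fibrewise sum of two points of a total space. It is only meaningful (and only used) for points
of the same fibre; otherwise the value is `x`. -/
def fadd (x y : TotalSpace F E) : TotalSpace F E :=
  if h : y.proj = x.proj then ⟨x.proj, x.snd + h ▸ y.snd⟩ else x

theorem fadd_mk (x : N) (u v : E x) :
    fadd (⟨x, u⟩ : TotalSpace F E) ⟨x, v⟩ = ⟨x, u + v⟩ := by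
  simp [fadd]

variable [∀ x, Module ℝ (E x)]

/-- Fibrewise scalar multiplication on a total space. -/
def fsmul (t : ℝ) (x : TotalSpace F E) : TotalSpace F E :=
  ⟨x.proj, t • x.snd⟩

open Classical in
/-- A family of bilinear forms on the fibres, as a function of two points of the total space. It is
only meaningful (and only used) for points of the same fibre; otherwise the value is `0`. -/
def evalForm (g : ∀ x, E x →ₗ[ℝ] E x →ₗ[ℝ] ℝ) (x y : TotalSpace F E) : ℝ :=
  if h : y.proj = x.proj then g x.proj x.snd (h ▸ y.snd) else 0

theorem evalForm_mk (g : ∀ x, E x →ₗ[ℝ] E x →ₗ[ℝ] ℝ) (x : N) (u v : E x) :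
    evalForm g (⟨x, u⟩ : TotalSpace F E) ⟨x, v⟩ = g x u v := by
  simp [evalForm]

end FibreOperations

/-! ### Double vector bundles -/

section Structures

variable (EM : Type*) [NormedAddCommGroup EM] [NormedSpace ℝ EM]
  {M : Type*} [TopologicalSpace M] [ChartedSpace EM M]
  (FQ : Type*) [NormedAddCommGroup FQ] [NormedSpace ℝ FQ]
  (Q : M → Type*) [∀ m, AddCommGroup (Q m)] [∀ m, Module ℝ (Q m)]
  [∀ m, TopologicalSpace (Q m)] [TopologicalSpace (TotalSpace FQ Q)]
  [FiberBundle FQ Q] [VectorBundle ℝ FQ Q]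
  (FB : Type*) [NormedAddCommGroup FB] [NormedSpace ℝ FB]
  (B : M → Type*) [∀ m, AddCommGroup (B m)] [∀ m, Module ℝ (B m)]
  [∀ m, TopologicalSpace (B m)] [TopologicalSpace (TotalSpace FB B)]
  [FiberBundle FB B] [VectorBundle ℝ FB B]
  (FEQ : Type*) [NormedAddCommGroup FEQ] [NormedSpace ℝ FEQ]
  (EQ : TotalSpace FQ Q → Type*) [∀ q, AddCommGroup (EQ q)] [∀ q, Module ℝ (EQ q)]
  [∀ q, TopologicalSpace (EQ q)] [TopologicalSpace (TotalSpace FEQ EQ)]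
  [FiberBundle FEQ EQ] [VectorBundle ℝ FEQ EQ]
  (FEB : Type*) [NormedAddCommGroup FEB] [NormedSpace ℝ FEB]
  (EB : TotalSpace FB B → Type*) [∀ b, AddCommGroup (EB b)] [∀ b, Module ℝ (EB b)]
  [∀ b, TopologicalSpace (EB b)] [TopologicalSpace (TotalSpace FEB EB)]
  [FiberBundle FEB EB] [VectorBundle ℝ FEB EB]

/-- A double vector bundle `(𝔼; Q, B; M)`. The smooth manifold `𝔼` is the total space of the vector
bundle `EB` over (the total space of) `B`; its second vector bundle structure, over (the total
space of) `Q`, is the vector bundle `EQ` over `Q` together with a diffeomorphism `flip` of the two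
total spaces. As `flip` is a diffeomorphism, all the structure maps of both structures are smooth
on `𝔼`.

The fields below `flip` say that the square of projections commutes and that the following are
morphisms of vector bundles (from the structures over `Q`):
* `π_B` over `q_Q` (`projB_addQ`, `projB_smulQ`);
* the addition `+_B` over the addition of `Q` (`projQ_addB`, `interchange`, `smulQ_addB`);
* every scalar multiplication `t ·_B` over the scalar multiplication by `t` on `Q`
  (`projQ_smulB`, `smulB_addQ`, `smulB_smulQ`). -/
structure DoubleVectorBundle where
  flip : Diffeomorph ((𝓘(ℝ, EM).prod 𝓘(ℝ, FB)).prod 𝓘(ℝ, FEB))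
    ((𝓘(ℝ, EM).prod 𝓘(ℝ, FQ)).prod 𝓘(ℝ, FEQ)) (TotalSpace FEB EB) (TotalSpace FEQ EQ) ∞
  proj_comm : ∀ d : TotalSpace FEB EB, (flip d).proj.proj = d.proj.proj
  projB_addQ : ∀ d d' : TotalSpace FEB EB, (flip d).proj = (flip d').proj →
    (flip.symm (fadd (flip d) (flip d'))).proj = fadd d.proj d'.proj
  projB_smulQ : ∀ (t : ℝ) (d : TotalSpace FEB EB),
    (flip.symm (fsmul t (flip d))).proj = fsmul t d.proj
  projQ_addB : ∀ d d' : TotalSpace FEB EB, d.proj = d'.proj →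
    (flip (fadd d d')).proj = fadd (flip d).proj (flip d').proj
  interchange : ∀ d₁ d₂ d₃ d₄ : TotalSpace FEB EB,
    (flip d₁).proj = (flip d₂).proj → (flip d₃).proj = (flip d₄).proj →
    d₁.proj = d₃.proj → d₂.proj = d₄.proj →
    fadd (flip.symm (fadd (flip d₁) (flip d₂))) (flip.symm (fadd (flip d₃) (flip d₄))) =
      flip.symm (fadd (flip (fadd d₁ d₃)) (flip (fadd d₂ d₄)))
  smulQ_addB : ∀ (t : ℝ) (d d' : TotalSpace FEB EB), d.proj = d'.proj →
    flip.symm (fsmul t (flip (fadd d d'))) =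
      fadd (flip.symm (fsmul t (flip d))) (flip.symm (fsmul t (flip d')))
  projQ_smulB : ∀ (t : ℝ) (d : TotalSpace FEB EB),
    (flip (fsmul t d)).proj = fsmul t (flip d).proj
  smulB_addQ : ∀ (t : ℝ) (d d' : TotalSpace FEB EB), (flip d).proj = (flip d').proj →
    fsmul t (flip.symm (fadd (flip d) (flip d'))) =
      flip.symm (fadd (flip (fsmul t d)) (flip (fsmul t d')))
  smulB_smulQ : ∀ (s t : ℝ) (d : TotalSpace FEB EB),
    fsmul t (flip.symm (fsmul s (flip d))) = flip.symm (fsmul s (flip (fsmul t d)))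

variable {EM FQ Q FB B FEQ EQ FEB EB}

namespace DoubleVectorBundle

variable (D : DoubleVectorBundle EM FQ Q FB B FEQ EQ FEB EB)

/-- The projection `π_Q : 𝔼 → Q`. -/
def projQ (d : TotalSpace FEB EB) : TotalSpace FQ Q := (D.flip d).proj

/-- The projection `π_B : 𝔼 → B`. -/
def projB (_D : DoubleVectorBundle EM FQ Q FB B FEQ EQ FEB EB) (d : TotalSpace FEB EB) :
    TotalSpace FB B := d.proj

/-- The addition `+_Q` of the vector bundle `𝔼 → Q`. -/
def addQ (d d' : TotalSpace FEB EB) : TotalSpace FEB EB :=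
  D.flip.symm (fadd (D.flip d) (D.flip d'))

/-- The scalar multiplication of the vector bundle `𝔼 → Q`. -/
def smulQ (t : ℝ) (d : TotalSpace FEB EB) : TotalSpace FEB EB :=
  D.flip.symm (fsmul t (D.flip d))

/-- The addition `+_B` of the vector bundle `𝔼 → B`. -/
def addB (_D : DoubleVectorBundle EM FQ Q FB B FEQ EQ FEB EB) (d d' : TotalSpace FEB EB) :
    TotalSpace FEB EB := fadd d d'

/-- The scalar multiplication of the vector bundle `𝔼 → B`. -/
def smulB (_D : DoubleVectorBundle EM FQ Q FB B FEQ EQ FEB EB) (t : ℝ) (d : TotalSpace FEB EB) :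
    TotalSpace FEB EB := fsmul t d

/-- The zero of the fibre of `𝔼 → Q` over `q`. -/
def zeroQ {m : M} (q : Q m) : TotalSpace FEB EB :=
  D.flip.symm ⟨⟨m, q⟩, 0⟩

/-- The zero of the fibre of `𝔼 → B` over `b`. -/
def zeroB (_D : DoubleVectorBundle EM FQ Q FB B FEQ EQ FEB EB) {m : M} (b : B m) :
    TotalSpace FEB EB := ⟨⟨m, b⟩, 0⟩

/-- `d` lies in the fibre over `m` of the core of `𝔼`, the intersection of the kernels of the two
projections. -/
def IsCore (m : M) (d : TotalSpace FEB EB) : Prop :=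
  D.projQ d = ⟨m, 0⟩ ∧ D.projB d = ⟨m, 0⟩

end DoubleVectorBundle

/-! ### Linear metrics -/

/-- A linear metric on `𝔼 → B`: a smooth symmetric non-degenerate bilinear pairing
`𝔼 ×_B 𝔼 → ℝ` that is linear over `Q`, i.e. such that the map `𝔼 → 𝔼*_B` it defines is also
fibrewise linear (additive and homogeneous) with respect to the vector bundle structure of `𝔼`
over `Q`. -/
structure LinearMetric (D : DoubleVectorBundle EM FQ Q FB B FEQ EQ FEB EB) where
  form : ∀ b : TotalSpace FB B, EB b →ₗ[ℝ] EB b →ₗ[ℝ] ℝ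
  smooth : ContMDiff ((𝓘(ℝ, EM).prod 𝓘(ℝ, FB)).prod 𝓘(ℝ, FEB × FEB)) 𝓘(ℝ, ℝ) ∞
    (fun p : TotalSpace (FEB × FEB) (EB ×ᵇ EB) => form p.proj p.snd.1 p.snd.2)
  symm : ∀ (b : TotalSpace FB B) (x y : EB b), form b x y = form b y x
  nondegenerate : ∀ (b : TotalSpace FB B) (x : EB b), (∀ y, form b x y = 0) → x = 0
  linear_add : ∀ e₁ e₂ f₁ f₂ : TotalSpace FEB EB,
    D.projB e₁ = D.projB f₁ → D.projB e₂ = D.projB f₂ →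
    D.projQ e₁ = D.projQ e₂ → D.projQ f₁ = D.projQ f₂ →
    evalForm form (D.addQ e₁ e₂) (D.addQ f₁ f₂) = evalForm form e₁ f₁ + evalForm form e₂ f₂
  linear_smul : ∀ (t : ℝ) (e f : TotalSpace FEB EB), D.projB e = D.projB f →
    evalForm form (D.smulQ t e) (D.smulQ t f) = t * evalForm form e f

/-! ### Linear splittings -/

/-- A linear splitting of `𝔼`: an injective morphism of double vector bundles
`Q ×_M B → 𝔼` over the identity on the sides `Q` and `B`. -/
structure LinearSplitting (D : DoubleVectorBundle EM FQ Q FB B FEQ EQ FEB EB) where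
  toFun : TotalSpace (FQ × FB) (Q ×ᵇ B) → TotalSpace FEB EB
  smooth : ContMDiff (𝓘(ℝ, EM).prod 𝓘(ℝ, FQ × FB))
    ((𝓘(ℝ, EM).prod 𝓘(ℝ, FB)).prod 𝓘(ℝ, FEB)) ∞ toFun
  injective : Function.Injective toFun
  projQ_eq : ∀ (m : M) (q : Q m) (b : B m), D.projQ (toFun ⟨m, (q, b)⟩) = ⟨m, q⟩
  projB_eq : ∀ (m : M) (q : Q m) (b : B m), D.projB (toFun ⟨m, (q, b)⟩) = ⟨m, b⟩
  map_addQ : ∀ (m : M) (q : Q m) (b b' : B m),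
    toFun ⟨m, (q, b + b')⟩ = D.addQ (toFun ⟨m, (q, b)⟩) (toFun ⟨m, (q, b')⟩)
  map_smulQ : ∀ (m : M) (t : ℝ) (q : Q m) (b : B m),
    toFun ⟨m, (q, t • b)⟩ = D.smulQ t (toFun ⟨m, (q, b)⟩)
  map_addB : ∀ (m : M) (q q' : Q m) (b : B m),
    toFun ⟨m, (q + q', b)⟩ = D.addB (toFun ⟨m, (q, b)⟩) (toFun ⟨m, (q', b)⟩)
  map_smulB : ∀ (m : M) (t : ℝ) (q : Q m) (b : B m),
    toFun ⟨m, (t • q, b)⟩ = D.smulB t (toFun ⟨m, (q, b)⟩)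

/-- The value `Σ(q, b)` of a linear splitting. -/
def LinearSplitting.val {D : DoubleVectorBundle EM FQ Q FB B FEQ EQ FEB EB}
    (S : LinearSplitting D) {m : M} (q : Q m) (b : B m) : TotalSpace FEB EB :=
  S.toFun ⟨m, (q, b)⟩

/-- The part of the image of a linear splitting in the fibre of `𝔼 → B` over `b`. -/
def LinearSplitting.imageAt {D : DoubleVectorBundle EM FQ Q FB B FEQ EQ FEB EB}
    (S : LinearSplitting D) (b : TotalSpace FB B) : Set (EB b) :=
  {x | (⟨b, x⟩ : TotalSpace FEB EB) ∈ Set.range S.toFun}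

namespace LinearMetric

variable {D : DoubleVectorBundle EM FQ Q FB B FEQ EQ FEB EB} (g : LinearMetric D)

/-- The pairing of two elements of `𝔼` over the same point of `B`. -/
def pair (d d' : TotalSpace FEB EB) : ℝ := evalForm g.form d d'

/-- A subset of a fibre of `𝔼 → B` is isotropic if the pairing vanishes on it. -/
def IsIsotropic (b : TotalSpace FB B) (L : Set (EB b)) : Prop :=
  ∀ x ∈ L, ∀ y ∈ L, g.form b x y = 0

/-- A linear splitting is Lagrangian if its image is maximal isotropic in `𝔼 → B`, i.e. in each
fibre. (A maximal isotropic subset is the same as a maximal isotropic subspace, because the span of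
an isotropic subset is isotropic.) -/
def IsLagrangian (S : LinearSplitting D) : Prop :=
  ∀ b : TotalSpace FB B, Maximal (g.IsIsotropic b) (S.imageAt b)

end LinearMetric

/-! ### Tensors and the difference of two linear splittings -/

variable (EM FQ Q FB B) in
/-- A smooth section `φ` of `Q* ⊗ Q* ⊗ B*`, as a smooth family of trilinear forms. -/
structure SmoothTensor where
  toFun : ∀ m : M, Q m →ₗ[ℝ] Q m →ₗ[ℝ] B m →ₗ[ℝ] ℝ
  smooth : ContMDiff (𝓘(ℝ, EM).prod 𝓘(ℝ, FQ × (FQ × FB))) 𝓘(ℝ, ℝ) ∞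
    (fun p : TotalSpace (FQ × (FQ × FB)) (Q ×ᵇ (Q ×ᵇ B)) =>
      toFun p.proj p.snd.1 p.snd.2.1 p.snd.2.2)

/-- `φ(q, q') = φ(q', q)` in `B*`. -/
def SmoothTensor.IsSymmetric (φ : SmoothTensor EM FQ Q FB B) : Prop :=
  ∀ (m : M) (q q' : Q m) (b : B m), φ.toFun m q q' b = φ.toFun m q' q b

/-- `φ(q, q') = -φ(q', q)` in `B*`, i.e. `φ` is a section of `(Q* ∧ Q*) ⊗ B*`. -/
def SmoothTensor.IsSkew (φ : SmoothTensor EM FQ Q FB B) : Prop :=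
  ∀ (m : M) (q q' : Q m) (b : B m), φ.toFun m q q' b = -φ.toFun m q' q b

namespace LinearMetric

variable {D : DoubleVectorBundle EM FQ Q FB B FEQ EQ FEB EB} (g : LinearMetric D)

/-- The identification of the core of `𝔼` with `Q*` given by the metric: the core element `c` over
`m` corresponds to `τ ∈ Q*_m` if `⟨0_q, c⟩ = τ(q)` for all `q ∈ Q_m`, where `0_q` is the zero of the
fibre of `𝔼 → Q` over `q`. -/
def CoreCorresponds {m : M} (c : TotalSpace FEB EB) (τ : Q m → ℝ) : Prop :=
  D.IsCore m c ∧ ∀ q : Q m, g.pair (D.zeroQ q) c = τ q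

/-- `Σ₁(q, b) -_B Σ₂(q, b) = 0_b +_Q c` for all `(q, b) ∈ Q ×_M B`, where `c` is the core element
that corresponds to `s • φ(q, ·)(b) ∈ Q*`. So `Σ₁` and `Σ₂` differ by the section `s • φ` of
`Q* ⊗ Q* ⊗ B*`. -/
def DifferBy (S₁ S₂ : LinearSplitting D) (s : ℝ) (φ : SmoothTensor EM FQ Q FB B) : Prop :=
  ∀ (m : M) (q : Q m) (b : B m), ∃ c : TotalSpace FEB EB,
    g.CoreCorresponds c (fun q' : Q m => s * φ.toFun m q q' b) ∧
    S₁.val q b = D.addB (S₂.val q b) (D.addQ (D.zeroB b) c)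

end LinearMetric

end Structures

end DVB

end

/-! A *core pairing* is a smooth map `K : 𝔼 ×_M Q → ℝ` that is linear in `𝔼` for both structures,
linear in `Q`, and equal to `⟨x, y⟩` at `(x, π_Q y)` whenever `π_Q x = 0`. Its kernel is a linear
splitting: the zeros of `𝔼 → Q` over `Q_m` are isotropic in the fibre of `𝔼 → B` over `0_m`, so the
rank of `𝔼 → B` is at least twice that of `Q`, and the injective map `x ↦ (π_Q x, K x)` is an
isomorphism of every fibre of `𝔼 → B` onto `Q_m × Q_m^*`.

Locally a core pairing is obtained by moving the zeros `0_q` to all fibres of `𝔼 → B` with a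
trivialization, pairing with them, and taking the derivative at `t = 0` along the homotheties
`t ·_Q`, which makes the result linear over `Q`. Core pairings form an affine space, so a partition
of unity on `M` gives a global one, and with it a linear splitting.

If `Σ₁` and `Σ₂` differ by `s φ`, then `⟨Σ₂, Σ₂⟩ = ⟨Σ₁, Σ₁⟩ - s (φ + φᵀ)`. For `φ = ⟨Σ₁, Σ₁⟩` and
`s = 1/2` the right-hand side vanishes, and such a `Σ₂` is the kernel of the core pairing
`⟨x, Σ₁ q⟩ - ½ ⟨Σ₁ (π_Q x), Σ₁ q⟩`. -/

noncomputable section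

namespace DVB

open Filter Topology

theorem exists_eq_mk_of_proj_eq {N F : Type*} {E : N → Type*} {d : TotalSpace F E} {x : N}
    (h : d.proj = x) : ∃ v : E x, d = ⟨x, v⟩ := by
  subst h
  exact ⟨d.snd, rfl⟩

theorem fsmul_mk {N F : Type*} {E : N → Type*} [∀ x, AddCommGroup (E x)] [∀ x, Module ℝ (E x)]
    (t : ℝ) (x : N) (v : E x) : fsmul t (⟨x, v⟩ : TotalSpace F E) = ⟨x, t • v⟩ := rfl

theorem contMDiffAt_clm_of_apply {EX : Type*} [NormedAddCommGroup EX] [NormedSpace ℝ EX]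
    {HX : Type*} [TopologicalSpace HX] {J : ModelWithCorners ℝ EX HX}
    {X : Type*} [TopologicalSpace X] [ChartedSpace HX X] {n : WithTop ℕ∞}
    {F : Type*} [NormedAddCommGroup F] [NormedSpace ℝ F] [FiniteDimensional ℝ F]
    {F' : Type*} [NormedAddCommGroup F'] [NormedSpace ℝ F'] {A : X → F →L[ℝ] F'} {x₀ : X}
    (h : ∀ v, ContMDiffAt J 𝓘(ℝ, F') n (fun x => A x v) x₀) :
    ContMDiffAt J 𝓘(ℝ, F →L[ℝ] F') n A x₀ := by
  let d := Module.finrank ℝ F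
  have hd : d = Module.finrank ℝ (Fin d → ℝ) := (Module.finrank_fin_fun ℝ).symm
  let e₁ := ContinuousLinearEquiv.ofFinrankEq hd
  let e₂ := (e₁.arrowCongr (1 : F' ≃L[ℝ] F')).trans (ContinuousLinearEquiv.piRing (Fin d))
  have h₂ : ContMDiffAt J 𝓘(ℝ, Fin d → F') n (fun x => e₂ (A x)) x₀ :=
    contMDiffAt_pi_space.2 fun i => h _
  have := e₂.symm.contDiff.contMDiff.contMDiffAt.comp (n := n) x₀ h₂
  refine this.congr_of_eventuallyEq (.of_forall fun x => ?_)
  simp only [Function.comp_apply, ContinuousLinearEquiv.symm_apply_apply]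

section BundleSmoothness

variable {EX : Type*} [NormedAddCommGroup EX] [NormedSpace ℝ EX]
  {HX : Type*} [TopologicalSpace HX] {J : ModelWithCorners ℝ EX HX}
  {X : Type*} [TopologicalSpace X] [ChartedSpace HX X]
  {EN : Type*} [NormedAddCommGroup EN] [NormedSpace ℝ EN]
  {HN : Type*} [TopologicalSpace HN] {I : ModelWithCorners ℝ EN HN}
  {N : Type*} [TopologicalSpace N] [ChartedSpace HN N] {n : WithTop ℕ∞}
  {F : Type*} [NormedAddCommGroup F] [NormedSpace ℝ F]
  {E : N → Type*} [∀ x, AddCommGroup (E x)] [∀ x, TopologicalSpace (E x)]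
  [TopologicalSpace (TotalSpace F E)] [FiberBundle F E]

theorem contMDiffAt_mk_prod_iff {F' : Type*} [NormedAddCommGroup F'] [NormedSpace ℝ F']
    {E' : N → Type*} [∀ x, AddCommGroup (E' x)] [∀ x, TopologicalSpace (E' x)]
    [TopologicalSpace (TotalSpace F' E')] [FiberBundle F' E']
    {b : X → N} {u : ∀ x, E (b x)} {v : ∀ x, E' (b x)} {x₀ : X} :
    ContMDiffAt J (I.prod 𝓘(ℝ, F × F')) n
        (fun x => (⟨b x, (u x, v x)⟩ : TotalSpace (F × F') (E ×ᵇ E'))) x₀ ↔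
      ContMDiffAt J (I.prod 𝓘(ℝ, F)) n (fun x => (⟨b x, u x⟩ : TotalSpace F E)) x₀ ∧
      ContMDiffAt J (I.prod 𝓘(ℝ, F')) n (fun x => (⟨b x, v x⟩ : TotalSpace F' E')) x₀ := by
  simp only [contMDiffAt_totalSpace]
  have key : ContMDiffAt J 𝓘(ℝ, F × F') n
      (fun x => (trivializationAt (F × F') (E ×ᵇ E') (b x₀) ⟨b x, (u x, v x)⟩).2) x₀ ↔
      ContMDiffAt J 𝓘(ℝ, F) n (fun x => (trivializationAt F E (b x₀) ⟨b x, u x⟩).2) x₀ ∧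
      ContMDiffAt J 𝓘(ℝ, F') n (fun x => (trivializationAt F' E' (b x₀) ⟨b x, v x⟩).2) x₀ :=
    contMDiffAt_prod_module_iff _
  rw [key]
  tauto

variable [∀ x, Module ℝ (E x)] [VectorBundle ℝ F E]

theorem contMDiffAt_fsmul {t : X → ℝ} {d : X → TotalSpace F E} {x₀ : X}
    (ht : ContMDiffAt J 𝓘(ℝ, ℝ) n t x₀) (hd : ContMDiffAt J (I.prod 𝓘(ℝ, F)) n d x₀) :
    ContMDiffAt J (I.prod 𝓘(ℝ, F)) n (fun x => fsmul (t x) (d x)) x₀ := by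
  rw [contMDiffAt_totalSpace] at hd ⊢
  refine ⟨hd.1, (ht.smul hd.2).congr_of_eventuallyEq ?_⟩
  have hmem : ∀ᶠ x in 𝓝 x₀, (d x).proj ∈ (trivializationAt F E (d x₀).proj).baseSet :=
    hd.1.continuousAt.eventually_mem
      ((trivializationAt F E _).open_baseSet.mem_nhds (mem_baseSet_trivializationAt F E _))
  filter_upwards [hmem] with x hx
  exact ((trivializationAt F E (d x₀).proj).linear ℝ hx).map_smul (t x) (d x).snd

theorem contMDiffAt_mk_symm [ContMDiffVectorBundle n F E I]
    (e : Trivialization F (π F E)) [MemTrivializationAtlas e] {b : X → N} {v : X → F} {x₀ : X}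
    (hb : ContMDiffAt J I n b x₀) (hv : ContMDiffAt J 𝓘(ℝ, F) n v x₀) (he : b x₀ ∈ e.baseSet) :
    ContMDiffAt J (I.prod 𝓘(ℝ, F)) n
      (fun x => (⟨b x, e.symm (b x) (v x)⟩ : TotalSpace F E)) x₀ := by
  rw [e.contMDiffAt_iff (e.mem_source.2 he)]
  refine ⟨hb, hv.congr_of_eventuallyEq ?_⟩
  filter_upwards [hb.continuousAt.eventually_mem (e.open_baseSet.mem_nhds he)] with x hx
  simp only [e.apply_mk_symm hx]

end BundleSmoothness

theorem two_mul_finrank_le_of_isotropic {K V W : Type*} [Field K] [AddCommGroup V]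
    [Module K V] [FiniteDimensional K V] [AddCommGroup W] [Module K W]
    {β : LinearMap.BilinForm K V} (hβ : β.Nondegenerate) {f : W →ₗ[K] V}
    (hf : Function.Injective f) (h : ∀ v w, β (f v) (f w) = 0) :
    2 * Module.finrank K W ≤ Module.finrank K V := by
  have hle : LinearMap.range f ≤ β.orthogonal (LinearMap.range f) := by
    rintro _ ⟨w, rfl⟩ _ ⟨v, rfl⟩
    exact h v w
  have h₁ := Submodule.finrank_mono hle
  have h₂ := Submodule.finrank_le (LinearMap.range f)
  rw [LinearMap.BilinForm.finrank_orthogonal hβ, LinearMap.finrank_range_of_inj hf] at h₁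
  rw [LinearMap.finrank_range_of_inj hf] at h₂
  omega

section RadialDerivative

variable {EN : Type*} [NormedAddCommGroup EN] [NormedSpace ℝ EN]
  {HN : Type*} [TopologicalSpace HN] {I : ModelWithCorners ℝ EN HN}
  {N : Type*} [TopologicalSpace N] [ChartedSpace HN N]
  {F : Type*} [NormedAddCommGroup F] [NormedSpace ℝ F]
  {E : N → Type*} [∀ x, AddCommGroup (E x)] [∀ x, Module ℝ (E x)] [∀ x, TopologicalSpace (E x)]
  [TopologicalSpace (TotalSpace F E)] [FiberBundle F E] [VectorBundle ℝ F E]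

theorem exists_linearMap_deriv_smul {G : TotalSpace F E → ℝ} {x : N}
    (hG : ContMDiffAt (I.prod 𝓘(ℝ, F)) 𝓘(ℝ, ℝ) 1 G ⟨x, 0⟩) :
    ∃ ℓ : E x →ₗ[ℝ] ℝ, ∀ u, deriv (fun t : ℝ => G ⟨x, t • u⟩) 0 = ℓ u := by
  let e := trivializationAt F E x
  have he : x ∈ e.baseSet := FiberBundle.mem_baseSet_trivializationAt F E x
  let a := e.continuousLinearEquivAt ℝ x he
  have hincl : ContMDiffAt 𝓘(ℝ, F) (I.prod 𝓘(ℝ, F)) 1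
      (fun w : F => (⟨x, a.symm w⟩ : TotalSpace F E)) 0 := by
    refine contMDiffAt_totalSpace.2 ⟨contMDiffAt_const, ?_⟩
    exact contMDiffAt_id.congr_of_eventuallyEq (.of_forall fun w => a.apply_symm_apply w)
  have hG₀ : DifferentiableAt ℝ (fun w => G ⟨x, a.symm w⟩) 0 := by
    refine (ContMDiffAt.comp (0 : F) ?_ hincl).contDiffAt.differentiableAt one_ne_zero
    rwa [map_zero]
  refine ⟨(fderiv ℝ (fun w => G ⟨x, a.symm w⟩) 0).toLinearMap ∘ₗ a.toLinearMap, fun u => ?_⟩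
  have hline : HasDerivAt (fun t : ℝ => t • a u) (a u) 0 := by
    simpa only [id, one_smul] using (hasDerivAt_id (0 : ℝ)).smul_const (a u)
  have h := (hG₀.hasFDerivAt.comp_hasDerivAt_of_eq (0 : ℝ) hline (zero_smul ℝ _).symm).deriv
  simp only [Function.comp_def, map_smul, ContinuousLinearEquiv.symm_apply_apply] at h
  exact h

end RadialDerivative

/-! ### The fibres of `𝔼 → B` -/

variable {EM : Type*} [NormedAddCommGroup EM] [NormedSpace ℝ EM]
  {M : Type*} [TopologicalSpace M] [ChartedSpace EM M]
  {FQ : Type*} [NormedAddCommGroup FQ] [NormedSpace ℝ FQ]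
  {Q : M → Type*} [∀ m, AddCommGroup (Q m)] [∀ m, Module ℝ (Q m)]
  [∀ m, TopologicalSpace (Q m)] [TopologicalSpace (TotalSpace FQ Q)] [FiberBundle FQ Q]
  {FB : Type*} [NormedAddCommGroup FB] [NormedSpace ℝ FB]
  {B : M → Type*} [∀ m, AddCommGroup (B m)] [∀ m, Module ℝ (B m)]
  [∀ m, TopologicalSpace (B m)] [TopologicalSpace (TotalSpace FB B)] [FiberBundle FB B]
  {FEQ : Type*} [NormedAddCommGroup FEQ] [NormedSpace ℝ FEQ]
  {EQ : TotalSpace FQ Q → Type*} [∀ q, AddCommGroup (EQ q)] [∀ q, Module ℝ (EQ q)]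
  [∀ q, TopologicalSpace (EQ q)] [TopologicalSpace (TotalSpace FEQ EQ)] [FiberBundle FEQ EQ]
  {FEB : Type*} [NormedAddCommGroup FEB] [NormedSpace ℝ FEB]
  {EB : TotalSpace FB B → Type*} [∀ b, AddCommGroup (EB b)] [∀ b, Module ℝ (EB b)]
  [∀ b, TopologicalSpace (EB b)] [TopologicalSpace (TotalSpace FEB EB)] [FiberBundle FEB EB]

namespace DoubleVectorBundle

variable (D : DoubleVectorBundle EM FQ Q FB B FEQ EQ FEB EB)

theorem projQ_proj (d : TotalSpace FEB EB) : (D.projQ d).proj = d.proj.proj := D.proj_comm d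

theorem projQ_fadd (d d' : TotalSpace FEB EB) (h : d.proj = d'.proj) :
    D.projQ (fadd d d') = fadd (D.projQ d) (D.projQ d') :=
  D.projQ_addB d d' h

theorem exists_projQ_mk (b : TotalSpace FB B) (x : EB b) :
    ∃ q : Q b.proj, D.projQ ⟨b, x⟩ = ⟨b.proj, q⟩ :=
  exists_eq_mk_of_proj_eq (D.projQ_proj ⟨b, x⟩)

/-- The restriction of `π_Q` to a fibre of `𝔼 → B`. -/
def fibQ (b : TotalSpace FB B) : EB b →ₗ[ℝ] Q b.proj where
  toFun x := (D.exists_projQ_mk b x).choose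
  map_add' x y := by
    have h := D.projQ_fadd ⟨b, x⟩ ⟨b, y⟩ rfl
    rw [fadd_mk, (D.exists_projQ_mk b x).choose_spec, (D.exists_projQ_mk b y).choose_spec,
      (D.exists_projQ_mk b (x + y)).choose_spec, fadd_mk] at h
    exact TotalSpace.mk_inj.1 h
  map_smul' t x := by
    have h : D.projQ _ = fsmul t (D.projQ _) := D.projQ_smulB t ⟨b, x⟩
    rw [fsmul_mk, (D.exists_projQ_mk b x).choose_spec,
      (D.exists_projQ_mk b (t • x)).choose_spec, fsmul_mk] at h
    exact TotalSpace.mk_inj.1 h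

theorem projQ_mk (b : TotalSpace FB B) (x : EB b) :
    D.projQ ⟨b, x⟩ = ⟨b.proj, D.fibQ b x⟩ :=
  (D.exists_projQ_mk b x).choose_spec

theorem fibQ_eq_iff {b : TotalSpace FB B} {x : EB b} {q : Q b.proj} :
    D.fibQ b x = q ↔ D.projQ ⟨b, x⟩ = ⟨b.proj, q⟩ := by
  rw [projQ_mk]
  exact TotalSpace.mk_inj.symm

theorem exists_eq_flip_symm {d : TotalSpace FEB EB} {q : TotalSpace FQ Q} (h : D.projQ d = q) :
    ∃ u : EQ q, d = D.flip.symm ⟨q, u⟩ := by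
  obtain ⟨u, hu⟩ := exists_eq_mk_of_proj_eq h
  exact ⟨u, by rw [← hu, D.flip.symm_apply_apply]⟩

theorem projQ_flip_symm (q : TotalSpace FQ Q) (u : EQ q) : D.projQ (D.flip.symm ⟨q, u⟩) = q := by
  rw [projQ, D.flip.apply_symm_apply]

theorem addQ_flip_symm (q : TotalSpace FQ Q) (u v : EQ q) :
    D.addQ (D.flip.symm ⟨q, u⟩) (D.flip.symm ⟨q, v⟩) = D.flip.symm ⟨q, u + v⟩ := by
  rw [addQ, D.flip.apply_symm_apply, D.flip.apply_symm_apply, fadd_mk]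

theorem smulQ_flip_symm (t : ℝ) (q : TotalSpace FQ Q) (u : EQ q) :
    D.smulQ t (D.flip.symm ⟨q, u⟩) = D.flip.symm ⟨q, t • u⟩ := by
  rw [smulQ, D.flip.apply_symm_apply, fsmul_mk]

theorem projQ_addQ {d d' : TotalSpace FEB EB} {q : TotalSpace FQ Q} (h : D.projQ d = q)
    (h' : D.projQ d' = q) : D.projQ (D.addQ d d') = q := by
  obtain ⟨u, rfl⟩ := D.exists_eq_flip_symm h
  obtain ⟨v, rfl⟩ := D.exists_eq_flip_symm h'
  rw [addQ_flip_symm, projQ_flip_symm]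

theorem projQ_smulQ (t : ℝ) (d : TotalSpace FEB EB) : D.projQ (D.smulQ t d) = D.projQ d := by
  obtain ⟨u, hu⟩ := D.exists_eq_flip_symm (d := d) rfl
  conv_lhs => rw [hu, smulQ_flip_symm, projQ_flip_symm]

theorem proj_smulQ (t : ℝ) (d : TotalSpace FEB EB) : (D.smulQ t d).proj = fsmul t d.proj :=
  D.projB_smulQ t d

theorem proj_addQ {d d' : TotalSpace FEB EB} {m : M} {b b' : B m}
    (h : D.projQ d = D.projQ d') (hb : d.proj = ⟨m, b⟩) (hb' : d'.proj = ⟨m, b'⟩) :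
    (D.addQ d d').proj = ⟨m, b + b'⟩ := by
  have := D.projB_addQ d d' h
  rwa [hb, hb', fadd_mk] at this

theorem projQ_eq_projQ {m : M} {b b' : B m} {x : EB ⟨m, b⟩} {x' : EB ⟨m, b'⟩}
    (h : D.fibQ ⟨m, b⟩ x = D.fibQ ⟨m, b'⟩ x') :
    D.projQ ⟨⟨m, b⟩, x⟩ = D.projQ ⟨⟨m, b'⟩, x'⟩ := by
  rw [projQ_mk, projQ_mk, h]

theorem exists_addQ_mk {m : M} {b b' : B m} {x : EB ⟨m, b⟩} {x' : EB ⟨m, b'⟩}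
    (h : D.fibQ ⟨m, b⟩ x = D.fibQ ⟨m, b'⟩ x') :
    ∃ y : EB ⟨m, b + b'⟩, D.addQ ⟨⟨m, b⟩, x⟩ ⟨⟨m, b'⟩, x'⟩ = ⟨⟨m, b + b'⟩, y⟩ ∧
      D.fibQ ⟨m, b + b'⟩ y = D.fibQ ⟨m, b⟩ x := by
  have h' := D.projQ_eq_projQ h
  obtain ⟨y, hy⟩ := exists_eq_mk_of_proj_eq (D.proj_addQ h' rfl rfl)
  refine ⟨y, hy, D.fibQ_eq_iff.2 ?_⟩
  rw [← hy, D.projQ_addQ rfl h'.symm, projQ_mk]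

theorem exists_smulQ_mk (t : ℝ) {m : M} {b : B m} (x : EB ⟨m, b⟩) :
    ∃ y : EB ⟨m, t • b⟩, D.smulQ t ⟨⟨m, b⟩, x⟩ = ⟨⟨m, t • b⟩, y⟩ ∧
      D.fibQ ⟨m, t • b⟩ y = D.fibQ ⟨m, b⟩ x := by
  obtain ⟨y, hy⟩ := exists_eq_mk_of_proj_eq (x := (⟨m, t • b⟩ : TotalSpace FB B))
    (D.proj_smulQ t ⟨⟨m, b⟩, x⟩)
  refine ⟨y, hy, D.fibQ_eq_iff.2 ?_⟩
  rw [← hy, projQ_smulQ, projQ_mk]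

theorem smulQ_zero {d : TotalSpace FEB EB} {m : M} {q : Q m} (h : D.projQ d = ⟨m, q⟩) :
    D.smulQ 0 d = D.zeroQ q := by
  obtain ⟨u, rfl⟩ := D.exists_eq_flip_symm h
  rw [smulQ_flip_symm, zero_smul, zeroQ]

theorem projQ_zeroQ {m : M} (q : Q m) : D.projQ (D.zeroQ q) = ⟨m, q⟩ := D.projQ_flip_symm _ _

theorem smulQ_zeroQ (t : ℝ) {m : M} (q : Q m) : D.smulQ t (D.zeroQ q) = D.zeroQ q := by
  rw [zeroQ, smulQ_flip_symm, smul_zero]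

theorem addQ_zeroQ {d : TotalSpace FEB EB} {m : M} {q : Q m} (h : D.projQ d = ⟨m, q⟩) :
    D.addQ d (D.zeroQ q) = d := by
  obtain ⟨u, rfl⟩ := D.exists_eq_flip_symm h
  rw [zeroQ, addQ_flip_symm, add_zero]

theorem proj_zeroQ {m : M} (q : Q m) : (D.zeroQ q).proj = ⟨m, 0⟩ := by
  have h : (D.zeroQ q).proj.proj = m :=
    (D.projQ_proj _).symm.trans (congrArg TotalSpace.proj (D.projQ_zeroQ q))
  obtain ⟨b, hb⟩ := exists_eq_mk_of_proj_eq h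
  have h' := D.proj_smulQ 0 (D.zeroQ q)
  rwa [smulQ_zeroQ, hb, fsmul_mk, zero_smul, ← hb] at h'

theorem proj_zeroQ_eq {m : M} (q q' : Q m) : (D.zeroQ q).proj = (D.zeroQ q').proj :=
  (D.proj_zeroQ q).trans (D.proj_zeroQ q').symm

theorem exists_zeroQ_mk {m : M} (q : Q m) : ∃ x : EB ⟨m, 0⟩, D.zeroQ q = ⟨⟨m, 0⟩, x⟩ :=
  exists_eq_mk_of_proj_eq (D.proj_zeroQ q)

/-- The zero section of `𝔼 → Q` as a linear map into the fibres of `𝔼 → B` over zero vectors. -/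
def fibZeroQ (m : M) : Q m →ₗ[ℝ] EB ⟨m, 0⟩ where
  toFun q := (D.exists_zeroQ_mk q).choose
  map_add' q q' := by
    have h : D.smulQ 0 _ = fadd (D.smulQ 0 _) (D.smulQ 0 _) :=
      D.smulQ_addB 0 (D.zeroQ q) (D.zeroQ q') (D.proj_zeroQ_eq q q')
    have h' : D.projQ (fadd (D.zeroQ q) (D.zeroQ q')) = ⟨m, q + q'⟩ := by
      rw [projQ_fadd _ _ _ (D.proj_zeroQ_eq q q'), projQ_zeroQ, projQ_zeroQ, fadd_mk]
    rw [D.smulQ_zero h', smulQ_zeroQ, smulQ_zeroQ, (D.exists_zeroQ_mk q).choose_spec,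
      (D.exists_zeroQ_mk q').choose_spec, (D.exists_zeroQ_mk (q + q')).choose_spec, fadd_mk] at h
    exact TotalSpace.mk_inj.1 h
  map_smul' t q := by
    have h : fsmul t (D.smulQ 0 _) = D.smulQ 0 _ := D.smulB_smulQ 0 t (D.zeroQ q)
    have h' : D.projQ (fsmul t (D.zeroQ q)) = ⟨m, t • q⟩ := by
      rw [projQ, D.projQ_smulB, ← projQ, projQ_zeroQ, fsmul_mk]
    rw [D.smulQ_zero h', smulQ_zeroQ, (D.exists_zeroQ_mk q).choose_spec,
      (D.exists_zeroQ_mk (t • q)).choose_spec, fsmul_mk] at h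
    exact (TotalSpace.mk_inj.1 h).symm

theorem zeroQ_eq_mk {m : M} (q : Q m) : D.zeroQ q = ⟨⟨m, 0⟩, D.fibZeroQ m q⟩ :=
  (D.exists_zeroQ_mk q).choose_spec

theorem fibQ_fibZeroQ {m : M} (q : Q m) : D.fibQ ⟨m, 0⟩ (D.fibZeroQ m q) = q := by
  rw [fibQ_eq_iff, ← zeroQ_eq_mk, projQ_zeroQ]

theorem projQ_zeroB {m : M} (b : B m) : D.projQ (D.zeroB b) = ⟨m, 0⟩ := by
  have := D.projQ_mk ⟨m, b⟩ 0
  rwa [map_zero] at this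

theorem exists_core_of_projQ_eq_zero {d : TotalSpace FEB EB} {m : M} {b : B m}
    (hb : d.proj = ⟨m, b⟩) (hq : D.projQ d = ⟨m, 0⟩) :
    ∃ c, D.IsCore m c ∧ d = D.addQ (D.zeroB b) c := by
  have hz := D.projQ_zeroB b
  have hs : D.projQ (D.smulQ (-1) (D.zeroB b)) = ⟨m, 0⟩ := by rw [projQ_smulQ, hz]
  refine ⟨D.addQ d (D.smulQ (-1) (D.zeroB b)), ⟨D.projQ_addQ hq hs, ?_⟩, ?_⟩
  · have h' : (D.smulQ (-1) (D.zeroB b)).proj = ⟨m, -b⟩ := by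
      rw [proj_smulQ, ← neg_one_smul ℝ b]
      rfl
    have := D.proj_addQ (hq.trans hs.symm) hb h'
    rwa [add_neg_cancel] at this
  · obtain ⟨u, rfl⟩ := D.exists_eq_flip_symm hq
    obtain ⟨v, hv⟩ := D.exists_eq_flip_symm hz
    rw [hv, smulQ_flip_symm, addQ_flip_symm, addQ_flip_symm, neg_one_smul,
      add_neg_cancel_comm_assoc]

end DoubleVectorBundle

namespace LinearMetric

variable {D : DoubleVectorBundle EM FQ Q FB B FEQ EQ FEB EB} (g : LinearMetric D)

theorem pair_mk (b : TotalSpace FB B) (x y : EB b) : g.pair ⟨b, x⟩ ⟨b, y⟩ = g.form b x y :=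
  evalForm_mk _ _ _ _

theorem form_addQ {m : M} {b b' : B m} {x y : EB ⟨m, b⟩} {x' y' : EB ⟨m, b'⟩}
    {z w : EB ⟨m, b + b'⟩} (hx : D.fibQ ⟨m, b⟩ x = D.fibQ ⟨m, b'⟩ x')
    (hy : D.fibQ ⟨m, b⟩ y = D.fibQ ⟨m, b'⟩ y')
    (hz : D.addQ ⟨⟨m, b⟩, x⟩ ⟨⟨m, b'⟩, x'⟩ = ⟨⟨m, b + b'⟩, z⟩)
    (hw : D.addQ ⟨⟨m, b⟩, y⟩ ⟨⟨m, b'⟩, y'⟩ = ⟨⟨m, b + b'⟩, w⟩) :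
    g.form ⟨m, b + b'⟩ z w = g.form ⟨m, b⟩ x y + g.form ⟨m, b'⟩ x' y' := by
  have h := g.linear_add ⟨⟨m, b⟩, x⟩ ⟨⟨m, b'⟩, x'⟩ ⟨⟨m, b⟩, y⟩ ⟨⟨m, b'⟩, y'⟩ rfl rfl
    (D.projQ_eq_projQ hx) (D.projQ_eq_projQ hy)
  rwa [hz, hw, evalForm_mk, evalForm_mk, evalForm_mk] at h

theorem form_smulQ {m : M} {b : B m} {t : ℝ} {x y : EB ⟨m, b⟩} {z w : EB ⟨m, t • b⟩}
    (hz : D.smulQ t ⟨⟨m, b⟩, x⟩ = ⟨⟨m, t • b⟩, z⟩)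
    (hw : D.smulQ t ⟨⟨m, b⟩, y⟩ = ⟨⟨m, t • b⟩, w⟩) :
    g.form ⟨m, t • b⟩ z w = t * g.form ⟨m, b⟩ x y := by
  have h := g.linear_smul t ⟨⟨m, b⟩, x⟩ ⟨⟨m, b⟩, y⟩ rfl
  rwa [hz, hw, evalForm_mk, evalForm_mk] at h

theorem form_fibZeroQ {m : M} (q q' : Q m) :
    g.form ⟨m, 0⟩ (D.fibZeroQ m q) (D.fibZeroQ m q') = 0 := by
  have h := g.linear_smul 0 (D.zeroQ q) (D.zeroQ q') (D.proj_zeroQ_eq q q')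
  rwa [D.smulQ_zeroQ, D.smulQ_zeroQ, zero_mul, D.zeroQ_eq_mk, D.zeroQ_eq_mk, evalForm_mk] at h

theorem pair_zeroB_addQ_core {m : M} {b : B m} {c : TotalSpace FEB EB} (hc : D.IsCore m c)
    (y : EB ⟨m, b⟩) : g.pair (D.addQ (D.zeroB b) c) ⟨⟨m, b⟩, y⟩ =
      g.pair (D.zeroQ (D.fibQ ⟨m, b⟩ y)) c := by
  have hy : D.projQ ⟨⟨m, b⟩, y⟩ = ⟨m, D.fibQ ⟨m, b⟩ y⟩ := D.projQ_mk _ _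
  have h := g.linear_add (D.zeroB b) c ⟨⟨m, b⟩, y⟩ (D.zeroQ (D.fibQ ⟨m, b⟩ y)) rfl
    (hc.2.trans (D.proj_zeroQ (D.fibQ ⟨m, b⟩ y)).symm) ((D.projQ_zeroB b).trans hc.1.symm)
    (hy.trans (D.projQ_zeroQ _).symm)
  rw [D.addQ_zeroQ hy, DoubleVectorBundle.zeroB, evalForm_mk, map_zero, LinearMap.zero_apply,
    zero_add] at h
  refine h.trans ?_
  obtain ⟨z, rfl⟩ := exists_eq_mk_of_proj_eq hc.2
  rw [D.zeroQ_eq_mk, evalForm_mk, pair_mk, g.symm]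

theorem exists_core {m : M} {b : B m} {x : EB ⟨m, b⟩} (hx : D.fibQ ⟨m, b⟩ x = 0) :
    ∃ c, D.IsCore m c ∧ (⟨⟨m, b⟩, x⟩ : TotalSpace FEB EB) = D.addQ (D.zeroB b) c ∧
      ∀ y, g.form ⟨m, b⟩ x y = g.pair (D.zeroQ (D.fibQ ⟨m, b⟩ y)) c := by
  obtain ⟨c, hc, h⟩ := D.exists_core_of_projQ_eq_zero (d := ⟨⟨m, b⟩, x⟩) rfl (D.fibQ_eq_iff.1 hx)
  exact ⟨c, hc, h, fun y => by rw [← g.pair_zeroB_addQ_core hc, ← h, pair_mk]⟩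

theorem form_congr_of_fibQ_eq {b : TotalSpace FB B} {x y y' : EB b} (hx : D.fibQ b x = 0)
    (h : D.fibQ b y = D.fibQ b y') : g.form b x y = g.form b x y' := by
  obtain ⟨m, b⟩ := b
  obtain ⟨c, -, -, hc⟩ := g.exists_core hx
  rw [hc, hc, h]

end LinearMetric

namespace LinearSplitting

variable {D : DoubleVectorBundle EM FQ Q FB B FEQ EQ FEB EB} (S : LinearSplitting D)

theorem exists_toFun_mk (b : TotalSpace FB B) (q : Q b.proj) :
    ∃ x : EB b, S.toFun ⟨b.proj, (q, b.snd)⟩ = ⟨b, x⟩ :=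
  exists_eq_mk_of_proj_eq (S.projB_eq b.proj q b.snd)

/-- The restriction of a linear splitting to a fibre over `B`. -/
def lift (b : TotalSpace FB B) : Q b.proj →ₗ[ℝ] EB b where
  toFun q := (S.exists_toFun_mk b q).choose
  map_add' q q' := by
    have h := S.map_addB b.proj q q' b.snd
    rw [(S.exists_toFun_mk b q).choose_spec, (S.exists_toFun_mk b q').choose_spec,
      (S.exists_toFun_mk b (q + q')).choose_spec, DoubleVectorBundle.addB, fadd_mk] at h
    exact TotalSpace.mk_inj.1 h
  map_smul' t q := by
    have h := S.map_smulB b.proj t q b.snd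
    rw [(S.exists_toFun_mk b q).choose_spec, (S.exists_toFun_mk b (t • q)).choose_spec,
      DoubleVectorBundle.smulB, fsmul_mk] at h
    exact TotalSpace.mk_inj.1 h

theorem val_eq_mk {m : M} (q : Q m) (b : B m) : S.val q b = ⟨⟨m, b⟩, S.lift ⟨m, b⟩ q⟩ :=
  (S.exists_toFun_mk ⟨m, b⟩ q).choose_spec

theorem fibQ_lift (b : TotalSpace FB B) (q : Q b.proj) : D.fibQ b (S.lift b q) = q := by
  rw [D.fibQ_eq_iff, ← S.projQ_eq b.proj q b.snd]
  exact congrArg D.projQ (S.val_eq_mk q b.snd).symm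

theorem fibQ_sub_lift_fibQ {b : TotalSpace FB B} (x : EB b) :
    D.fibQ b (x - S.lift b (D.fibQ b x)) = 0 := by
  rw [map_sub, S.fibQ_lift, sub_self]

theorem lift_addQ {m : M} (q : Q m) (b b' : B m) :
    D.addQ ⟨⟨m, b⟩, S.lift ⟨m, b⟩ q⟩ ⟨⟨m, b'⟩, S.lift ⟨m, b'⟩ q⟩ =
      ⟨⟨m, b + b'⟩, S.lift ⟨m, b + b'⟩ q⟩ := by
  rw [← val_eq_mk, ← val_eq_mk, ← val_eq_mk]
  exact (S.map_addQ m q b b').symm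

theorem lift_smulQ {m : M} (t : ℝ) (q : Q m) (b : B m) :
    D.smulQ t ⟨⟨m, b⟩, S.lift ⟨m, b⟩ q⟩ = ⟨⟨m, t • b⟩, S.lift ⟨m, t • b⟩ q⟩ := by
  rw [← val_eq_mk, ← val_eq_mk]
  exact (S.map_smulQ m t q b).symm

theorem mem_imageAt {b : TotalSpace FB B} {x : EB b} :
    x ∈ S.imageAt b ↔ ∃ q, S.lift b q = x := by
  obtain ⟨m, b⟩ := b
  constructor
  · rintro ⟨⟨m', q, b'⟩, h⟩
    replace h : S.val q b' = ⟨⟨m, b⟩, x⟩ := h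
    rw [S.val_eq_mk] at h
    have hb : (⟨m', b'⟩ : TotalSpace FB B) = ⟨m, b⟩ := congrArg TotalSpace.proj h
    cases hb
    exact ⟨q, TotalSpace.mk_inj.1 h⟩
  · rintro ⟨q, rfl⟩
    exact ⟨⟨m, (q, b)⟩, S.val_eq_mk q b⟩

/-- The linear splitting with given restrictions to the fibres over `B`. -/
def ofLift (σ : ∀ b : TotalSpace FB B, Q b.proj →ₗ[ℝ] EB b)
    (fibQ_σ : ∀ b q, D.fibQ b (σ b q) = q)
    (smooth : ContMDiff (𝓘(ℝ, EM).prod 𝓘(ℝ, FQ × FB))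
      ((𝓘(ℝ, EM).prod 𝓘(ℝ, FB)).prod 𝓘(ℝ, FEB)) ∞
      (fun p : TotalSpace (FQ × FB) (Q ×ᵇ B) =>
        (⟨⟨p.proj, p.snd.2⟩, σ ⟨p.proj, p.snd.2⟩ p.snd.1⟩ : TotalSpace FEB EB)))
    (addQ : ∀ (m : M) (q : Q m) (b b' : B m),
      D.addQ ⟨⟨m, b⟩, σ ⟨m, b⟩ q⟩ ⟨⟨m, b'⟩, σ ⟨m, b'⟩ q⟩ = ⟨⟨m, b + b'⟩, σ ⟨m, b + b'⟩ q⟩)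
    (smulQ : ∀ (m : M) (t : ℝ) (q : Q m) (b : B m),
      D.smulQ t ⟨⟨m, b⟩, σ ⟨m, b⟩ q⟩ = ⟨⟨m, t • b⟩, σ ⟨m, t • b⟩ q⟩) :
    LinearSplitting D where
  toFun p := ⟨⟨p.proj, p.snd.2⟩, σ ⟨p.proj, p.snd.2⟩ p.snd.1⟩
  smooth := smooth
  injective := by
    rintro ⟨m, q, b⟩ ⟨m', q', b'⟩ h
    have hb : (⟨m, b⟩ : TotalSpace FB B) = ⟨m', b'⟩ := congrArg TotalSpace.proj h
    cases hb
    have h' := congrArg (D.fibQ ⟨m, b⟩) (TotalSpace.mk_inj.1 h)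
    rw [fibQ_σ, fibQ_σ] at h'
    cases h'
    rfl
  projQ_eq m q b := D.fibQ_eq_iff.1 (fibQ_σ ⟨m, b⟩ q)
  projB_eq m q b := rfl
  map_addQ m q b b' := (addQ m q b b').symm
  map_smulQ m t q b := (smulQ m t q b).symm
  map_addB m q q' b := by rw [DoubleVectorBundle.addB, fadd_mk, map_add]
  map_smulB m t q b := by rw [DoubleVectorBundle.smulB, fsmul_mk, map_smul]

end LinearSplitting

namespace LinearMetric

variable {D : DoubleVectorBundle EM FQ Q FB B FEQ EQ FEB EB} (g : LinearMetric D)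

theorem isLagrangian_iff (S : LinearSplitting D) :
    g.IsLagrangian S ↔
      ∀ (b : TotalSpace FB B) (q q' : Q b.proj), g.form b (S.lift b q) (S.lift b q') = 0 := by
  constructor
  · intro h b q q'
    exact (h b).prop _ (S.mem_imageAt.2 ⟨q, rfl⟩) _ (S.mem_imageAt.2 ⟨q', rfl⟩)
  · intro h b
    refine ⟨?_, fun L hL hSL x hx => ?_⟩
    · intro x hx y hy
      obtain ⟨q, rfl⟩ := S.mem_imageAt.1 hx
      obtain ⟨q', rfl⟩ := S.mem_imageAt.1 hy
      exact h b q q'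
    · refine S.mem_imageAt.2 ⟨D.fibQ b x, (sub_eq_zero.1 (g.nondegenerate b _ fun y => ?_)).symm⟩
      rw [g.form_congr_of_fibQ_eq (S.fibQ_sub_lift_fibQ x) (S.fibQ_lift b (D.fibQ b y)).symm,
        map_sub, LinearMap.sub_apply, h, hL x hx _ (hSL (S.mem_imageAt.2 ⟨_, rfl⟩)), sub_zero]

theorem differBy_iff {S₁ S₂ : LinearSplitting D} (S : LinearSplitting D) {s : ℝ}
    {φ : SmoothTensor EM FQ Q FB B} :
    g.DifferBy S₁ S₂ s φ ↔ ∀ (m : M) (q q' : Q m) (b : B m),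
      g.form ⟨m, b⟩ (S₁.lift ⟨m, b⟩ q - S₂.lift ⟨m, b⟩ q) (S.lift ⟨m, b⟩ q') =
        s * φ.toFun m q q' b := by
  constructor
  · intro h m q q' b
    obtain ⟨c, ⟨hc, hcφ⟩, hval⟩ := h m q b
    have hproj := D.proj_addQ ((D.projQ_zeroB b).trans hc.1.symm) rfl hc.2
    rw [add_zero] at hproj
    obtain ⟨z, hz⟩ := exists_eq_mk_of_proj_eq hproj
    rw [S₁.val_eq_mk, S₂.val_eq_mk, hz, DoubleVectorBundle.addB, fadd_mk] at hval
    rw [TotalSpace.mk_inj.1 hval, add_sub_cancel_left, ← pair_mk, ← hz,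
      g.pair_zeroB_addQ_core hc, S.fibQ_lift, hcφ]
  · intro h m q b
    have hx : D.fibQ ⟨m, b⟩ (S₁.lift ⟨m, b⟩ q - S₂.lift ⟨m, b⟩ q) = 0 := by
      rw [map_sub, S₁.fibQ_lift, S₂.fibQ_lift, sub_self]
    obtain ⟨c, hc, hmk, hform⟩ := g.exists_core hx
    refine ⟨c, ⟨hc, fun q' => ?_⟩, ?_⟩
    · simpa only [h, S.fibQ_lift] using (hform (S.lift ⟨m, b⟩ q')).symm
    · rw [← hmk, S₁.val_eq_mk, S₂.val_eq_mk, DoubleVectorBundle.addB, fadd_mk, add_sub_cancel]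

end LinearMetric

/-! ### Core pairings and their kernels -/

namespace DoubleVectorBundle

variable (D : DoubleVectorBundle EM FQ Q FB B FEQ EQ FEB EB)
  {EX : Type*} [NormedAddCommGroup EX] [NormedSpace ℝ EX]
  {HX : Type*} [TopologicalSpace HX] {J : ModelWithCorners ℝ EX HX}
  {X : Type*} [TopologicalSpace X] [ChartedSpace HX X]

theorem contMDiffAt_projQ {d : X → TotalSpace FEB EB} {x₀ : X}
    (hd : ContMDiffAt J ((𝓘(ℝ, EM).prod 𝓘(ℝ, FB)).prod 𝓘(ℝ, FEB)) ∞ d x₀) :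
    ContMDiffAt J (𝓘(ℝ, EM).prod 𝓘(ℝ, FQ)) ∞ (fun x => D.projQ (d x)) x₀ :=
  (contMDiff_proj EQ).contMDiffAt.comp x₀ (D.flip.contMDiff.contMDiffAt.comp x₀ hd)

end DoubleVectorBundle

namespace LinearMetric

variable {D : DoubleVectorBundle EM FQ Q FB B FEQ EQ FEB EB} (g : LinearMetric D)

/-- The algebraic conditions over `m` on a core pairing, see `IsCorePairing`. -/
structure IsCorePairingAt (K : ∀ b : TotalSpace FB B, EB b →ₗ[ℝ] Q b.proj →ₗ[ℝ] ℝ) (m : M) :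
    Prop where
  addQ : ∀ {b b' : B m} {x : EB ⟨m, b⟩} {x' : EB ⟨m, b'⟩} {y : EB ⟨m, b + b'⟩} (q : Q m),
    D.fibQ ⟨m, b⟩ x = D.fibQ ⟨m, b'⟩ x' → D.addQ ⟨⟨m, b⟩, x⟩ ⟨⟨m, b'⟩, x'⟩ = ⟨⟨m, b + b'⟩, y⟩ →
    K ⟨m, b + b'⟩ y q = K ⟨m, b⟩ x q + K ⟨m, b'⟩ x' q
  smulQ : ∀ {b : B m} {t : ℝ} {x : EB ⟨m, b⟩} {y : EB ⟨m, t • b⟩} (q : Q m),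
    D.smulQ t ⟨⟨m, b⟩, x⟩ = ⟨⟨m, t • b⟩, y⟩ → K ⟨m, t • b⟩ y q = t * K ⟨m, b⟩ x q
  core : ∀ {b : B m} {x : EB ⟨m, b⟩}, D.fibQ ⟨m, b⟩ x = 0 → ∀ y : EB ⟨m, b⟩,
    K ⟨m, b⟩ x (D.fibQ ⟨m, b⟩ y) = g.form ⟨m, b⟩ x y

variable (EM FQ) in
/-- Smoothness at `d₀` of a family of pairings of the fibres of `𝔼 → B` with those of `Q`, tested
on the sections of `Q` that are smooth at the point of `M` below `d₀`. -/
def SmoothPairingAt (K : ∀ b : TotalSpace FB B, EB b →ₗ[ℝ] Q b.proj →ₗ[ℝ] ℝ)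
    (d₀ : TotalSpace FEB EB) : Prop :=
  ∀ s : ∀ m, Q m, ContMDiffAt 𝓘(ℝ, EM) (𝓘(ℝ, EM).prod 𝓘(ℝ, FQ)) ∞
      (fun m => (⟨m, s m⟩ : TotalSpace FQ Q)) d₀.proj.proj →
    ContMDiffAt ((𝓘(ℝ, EM).prod 𝓘(ℝ, FB)).prod 𝓘(ℝ, FEB)) 𝓘(ℝ, ℝ) ∞
      (fun d : TotalSpace FEB EB => K d.proj d.snd (s d.proj.proj)) d₀

/-- A core pairing: a smooth map `K : 𝔼 ×_M Q → ℝ` that is linear in the first argument for both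
structures, linear in the second one, and restricts to the pairing of `Q` with the core `Q*`. By
`IsCorePairing.splitting` its kernel is a linear splitting. -/
structure IsCorePairing (K : ∀ b : TotalSpace FB B, EB b →ₗ[ℝ] Q b.proj →ₗ[ℝ] ℝ) : Prop where
  isCorePairingAt : ∀ m, g.IsCorePairingAt K m
  smoothPairingAt : ∀ d₀ : TotalSpace FEB EB, SmoothPairingAt EM FQ K d₀

section Rank

variable [VectorBundle ℝ FQ Q] [VectorBundle ℝ FEB EB] [FiniteDimensional ℝ FEB]

include g in
theorem two_mul_finrank_le (m : M) : 2 * Module.finrank ℝ FQ ≤ Module.finrank ℝ FEB := by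
  have := VectorBundle.finiteDimensional ℝ FEB EB ⟨m, 0⟩
  have hnondeg : (g.form ⟨m, 0⟩).Nondegenerate :=
    ⟨fun x hx => g.nondegenerate _ x hx,
      fun x hx => g.nondegenerate _ x fun y => (g.symm _ x y).trans (hx y)⟩
  have hinj : Function.Injective (D.fibZeroQ m) :=
    Function.LeftInverse.injective (g := D.fibQ ⟨m, 0⟩) D.fibQ_fibZeroQ
  rw [← VectorBundle.finrank_eq ℝ FQ Q m, ← VectorBundle.finrank_eq ℝ FEB EB ⟨m, 0⟩]
  exact two_mul_finrank_le_of_isotropic hnondeg hinj g.form_fibZeroQ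

end Rank

namespace IsCorePairing

variable {g} {K : ∀ b : TotalSpace FB B, EB b →ₗ[ℝ] Q b.proj →ₗ[ℝ] ℝ} (hK : g.IsCorePairing K)
include hK

theorem injective_fibQ_prod (b : TotalSpace FB B) :
    Function.Injective ((D.fibQ b).prod (K b)) := by
  rw [injective_iff_map_eq_zero]
  intro x hx
  obtain ⟨hq, hk⟩ := Prod.mk.inj hx
  refine g.nondegenerate b x fun y => ?_
  rw [← (hK.isCorePairingAt b.proj).core hq y]
  exact LinearMap.congr_fun hk _

variable [VectorBundle ℝ FQ Q] [FiniteDimensional ℝ FQ]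
  [VectorBundle ℝ FEB EB] [FiniteDimensional ℝ FEB]

theorem bijective_fibQ_prod (b : TotalSpace FB B) :
    Function.Bijective ((D.fibQ b).prod (K b)) := by
  have hE := VectorBundle.finiteDimensional ℝ FEB EB b
  have hQ := VectorBundle.finiteDimensional ℝ FQ Q b.proj
  have hinj := hK.injective_fibQ_prod b
  have hrank : Module.finrank ℝ (EB b) =
      Module.finrank ℝ (Q b.proj × Module.Dual ℝ (Q b.proj)) := by
    refine le_antisymm (LinearMap.finrank_le_finrank_of_injective hinj) ?_
    rw [Module.finrank_prod, Subspace.dual_finrank_eq, ← two_mul, VectorBundle.finrank_eq ℝ FQ,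
      VectorBundle.finrank_eq ℝ FEB]
    exact g.two_mul_finrank_le b.proj
  exact ⟨hinj, (LinearMap.injective_iff_surjective_of_finrank_eq_finrank hrank).1 hinj⟩

/-- The decomposition of a fibre of `𝔼 → B` defined by a core pairing. -/
def fibreEquiv (b : TotalSpace FB B) : EB b ≃ₗ[ℝ] Q b.proj × Module.Dual ℝ (Q b.proj) :=
  .ofBijective ((D.fibQ b).prod (K b)) (hK.bijective_fibQ_prod b)

theorem fibreEquiv_apply (b : TotalSpace FB B) (x : EB b) :
    hK.fibreEquiv b x = (D.fibQ b x, K b x) := rfl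

/-- The linear section of `𝔼 → Q` over `b` that is annihilated by a core pairing. -/
def lift (b : TotalSpace FB B) : Q b.proj →ₗ[ℝ] EB b :=
  (hK.fibreEquiv b).symm.toLinearMap ∘ₗ LinearMap.inl ℝ _ _

theorem eq_lift_iff {b : TotalSpace FB B} {x : EB b} {q : Q b.proj} :
    x = hK.lift b q ↔ D.fibQ b x = q ∧ K b x = 0 :=
  (LinearEquiv.eq_symm_apply _).trans Prod.mk_inj

theorem fibQ_lift (b : TotalSpace FB B) (q : Q b.proj) : D.fibQ b (hK.lift b q) = q :=
  (hK.eq_lift_iff.1 rfl).1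

theorem apply_lift (b : TotalSpace FB B) (q : Q b.proj) : K b (hK.lift b q) = 0 :=
  (hK.eq_lift_iff.1 rfl).2

theorem lift_addQ (m : M) (q : Q m) (b b' : B m) :
    D.addQ ⟨⟨m, b⟩, hK.lift ⟨m, b⟩ q⟩ ⟨⟨m, b'⟩, hK.lift ⟨m, b'⟩ q⟩ =
      ⟨⟨m, b + b'⟩, hK.lift ⟨m, b + b'⟩ q⟩ := by
  have hq : D.fibQ ⟨m, b⟩ (hK.lift ⟨m, b⟩ q) = D.fibQ ⟨m, b'⟩ (hK.lift ⟨m, b'⟩ q) := by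
    rw [fibQ_lift, fibQ_lift]
  obtain ⟨y, hy, hyq⟩ := D.exists_addQ_mk hq
  have hKy : ∀ q' : Q m, K ⟨m, b + b'⟩ y q' = 0 := fun q' =>
    ((hK.isCorePairingAt m).addQ q' hq hy).trans
      ((congrArg₂ (· + ·) (LinearMap.congr_fun (hK.apply_lift ⟨m, b⟩ q) q')
        (LinearMap.congr_fun (hK.apply_lift ⟨m, b'⟩ q) q')).trans (add_zero 0))
  rw [hy, hK.eq_lift_iff.2 ⟨hyq.trans (hK.fibQ_lift ⟨m, b⟩ q), LinearMap.ext hKy⟩]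

theorem lift_smulQ (m : M) (t : ℝ) (q : Q m) (b : B m) :
    D.smulQ t ⟨⟨m, b⟩, hK.lift ⟨m, b⟩ q⟩ = ⟨⟨m, t • b⟩, hK.lift ⟨m, t • b⟩ q⟩ := by
  obtain ⟨y, hy, hyq⟩ := D.exists_smulQ_mk t (hK.lift ⟨m, b⟩ q)
  have hKy : ∀ q' : Q m, K ⟨m, t • b⟩ y q' = 0 := fun q' =>
    ((hK.isCorePairingAt m).smulQ q' hy).trans
      ((congrArg (t * ·) (LinearMap.congr_fun (hK.apply_lift ⟨m, b⟩ q) q')).trans (mul_zero t))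
  rw [hy, hK.eq_lift_iff.2 ⟨hyq.trans (hK.fibQ_lift ⟨m, b⟩ q), LinearMap.ext hKy⟩]

end IsCorePairing

end LinearMetric

namespace LinearMetric

variable {D : DoubleVectorBundle EM FQ Q FB B FEQ EQ FEB EB} {g : LinearMetric D}
  {K : ∀ b : TotalSpace FB B, EB b →ₗ[ℝ] Q b.proj →ₗ[ℝ] ℝ}
  [FiniteDimensional ℝ FQ] [FiniteDimensional ℝ FEB]

section Coordinates

variable (e : Trivialization FEB (π FEB EB)) (eQ : Trivialization FQ (π FQ Q))

variable (D K) in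
/-- The matrix of `x ↦ (π_Q x, K x)` in linear trivializations of `𝔼 → B` and `Q → M`. -/
def coord [e.IsLinear ℝ] [eQ.IsLinear ℝ] (b : TotalSpace FB B) :
    FEB →L[ℝ] FQ × (FQ →L[ℝ] ℝ) :=
  LinearMap.toContinuousLinearMap
    ((eQ.linearMapAt ℝ b.proj ∘ₗ D.fibQ b ∘ₗ e.symmₗ ℝ b).prod
      (LinearMap.toContinuousLinearMap.toLinearMap ∘ₗ
        (K b).compl₁₂ (e.symmₗ ℝ b) (eQ.symmₗ ℝ b.proj)))

variable {e eQ}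

section

variable [e.IsLinear ℝ] [eQ.IsLinear ℝ] {b : TotalSpace FB B}

theorem coord_fst (he : b ∈ e.baseSet) (heQ : b.proj ∈ eQ.baseSet) (v : FEB) :
    (coord D K e eQ b v).1 = (eQ ⟨b.proj, D.fibQ b (e.symm b v)⟩).2 := by
  simp [coord, he, heQ]

theorem coord_snd (he : b ∈ e.baseSet) (heQ : b.proj ∈ eQ.baseSet) (v : FEB) (w : FQ) :
    (coord D K e eQ b v).2 w = K b (e.symm b v) (eQ.symm b.proj w) := by
  simp [coord, he, heQ]

variable [VectorBundle ℝ FQ Q] [VectorBundle ℝ FEB EB]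

theorem IsCorePairing.isInvertible_coord (hK : g.IsCorePairing K) (he : b ∈ e.baseSet)
    (heQ : b.proj ∈ eQ.baseSet) : (coord D K e eQ b).IsInvertible := by
  let a := (e.continuousLinearEquivAt ℝ b he).toLinearEquiv
  let aQ := (eQ.continuousLinearEquivAt ℝ b.proj heQ).toLinearEquiv
  refine ⟨(a.symm ≪≫ₗ hK.fibreEquiv b ≪≫ₗ LinearEquiv.prodCongr aQ
    (aQ.symm.dualMap ≪≫ₗ LinearMap.toContinuousLinearMap)).toContinuousLinearEquiv, ?_⟩
  ext v w <;> simp [fibreEquiv_apply, coord_fst he heQ, coord_snd he heQ, a, aQ]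

theorem IsCorePairing.coord_apply_lift (hK : g.IsCorePairing K) (he : b ∈ e.baseSet)
    (heQ : b.proj ∈ eQ.baseSet) (q : Q b.proj) :
    coord D K e eQ b (e ⟨b, hK.lift b q⟩).2 = ((eQ ⟨b.proj, q⟩).2, 0) := by
  have h := e.symm_apply_apply_mk he (hK.lift b q)
  refine Prod.ext ?_ (ContinuousLinearMap.ext fun w => ?_)
  · rw [coord_fst he heQ, h, hK.fibQ_lift]
  · rw [coord_snd he heQ, h, hK.apply_lift]
    rfl

end

variable [VectorBundle ℝ FQ Q] [ContMDiffVectorBundle ∞ FQ Q 𝓘(ℝ, EM)]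
  [VectorBundle ℝ FEB EB] [ContMDiffVectorBundle ∞ FEB EB (𝓘(ℝ, EM).prod 𝓘(ℝ, FB))]
  [MemTrivializationAtlas e] [MemTrivializationAtlas eQ]

theorem IsCorePairing.contMDiffAt_coord (hK : g.IsCorePairing K) {b₀ : TotalSpace FB B}
    (he : b₀ ∈ e.baseSet) (heQ : b₀.proj ∈ eQ.baseSet) :
    ContMDiffAt (𝓘(ℝ, EM).prod 𝓘(ℝ, FB)) 𝓘(ℝ, FEB →L[ℝ] FQ × (FQ →L[ℝ] ℝ)) ∞
      (coord D K e eQ) b₀ := by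
  have hframe : ∀ v : FEB, ContMDiffAt (𝓘(ℝ, EM).prod 𝓘(ℝ, FB))
      ((𝓘(ℝ, EM).prod 𝓘(ℝ, FB)).prod 𝓘(ℝ, FEB)) ∞
      (fun b : TotalSpace FB B => (⟨b, e.symm b v⟩ : TotalSpace FEB EB)) b₀ := fun v =>
    contMDiffAt_mk_symm e contMDiffAt_id contMDiffAt_const he
  have hmem : ∀ᶠ b : TotalSpace FB B in 𝓝 b₀, b ∈ e.baseSet ∧ b.proj ∈ eQ.baseSet :=
    (e.open_baseSet.eventually_mem he).and
      ((FiberBundle.continuous_proj FB B).continuousAt.eventually_mem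
        (eQ.open_baseSet.mem_nhds heQ))
  refine contMDiffAt_clm_of_apply fun v =>
    (contMDiffAt_prod_module_iff _).2 ⟨?_, contMDiffAt_clm_of_apply fun w => ?_⟩
  · have hq : D.projQ ⟨b₀, e.symm b₀ v⟩ ∈ eQ.source := by
      rw [eQ.mem_source, D.projQ_proj]
      exact heQ
    have hcoe := ((eQ.contMDiffAt_iff hq).1 (D.contMDiffAt_projQ contMDiffAt_id)).2
    refine (hcoe.comp b₀ (hframe v)).congr_of_eventuallyEq
      (f₁ := fun b => (coord D K e eQ b v).1) ?_
    filter_upwards [hmem] with b hb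
    rw [coord_fst hb.1 hb.2, ← D.projQ_mk]
    rfl
  · have hs := hK.smoothPairingAt ⟨b₀, e.symm b₀ v⟩ (fun m => eQ.symm m w)
      (contMDiffAt_mk_symm eQ contMDiffAt_id contMDiffAt_const heQ)
    refine (hs.comp b₀ (hframe v)).congr_of_eventuallyEq
      (f₁ := fun b => (coord D K e eQ b v).2 w) (hmem.mono fun b hb => coord_snd hb.1 hb.2 v w)

end Coordinates

namespace IsCorePairing

variable [VectorBundle ℝ FQ Q] [ContMDiffVectorBundle ∞ FQ Q 𝓘(ℝ, EM)]
  [VectorBundle ℝ FEB EB] [ContMDiffVectorBundle ∞ FEB EB (𝓘(ℝ, EM).prod 𝓘(ℝ, FB))]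

theorem contMDiff_lift (hK : g.IsCorePairing K) :
    ContMDiff (𝓘(ℝ, EM).prod 𝓘(ℝ, FQ × FB)) ((𝓘(ℝ, EM).prod 𝓘(ℝ, FB)).prod 𝓘(ℝ, FEB)) ∞
      (fun p : TotalSpace (FQ × FB) (Q ×ᵇ B) =>
        (⟨⟨p.proj, p.snd.2⟩, hK.lift ⟨p.proj, p.snd.2⟩ p.snd.1⟩ : TotalSpace FEB EB)) := by
  intro p₀
  let b : TotalSpace (FQ × FB) (Q ×ᵇ B) → TotalSpace FB B := fun p => ⟨p.proj, p.snd.2⟩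
  obtain ⟨hq, hb⟩ := contMDiffAt_mk_prod_iff.1 (contMDiffAt_id (I := 𝓘(ℝ, EM).prod 𝓘(ℝ, FQ × FB))
    (n := ∞) (x := p₀))
  let e := trivializationAt FEB EB (b p₀)
  let eQ := trivializationAt FQ Q p₀.proj
  have he : b p₀ ∈ e.baseSet := FiberBundle.mem_baseSet_trivializationAt FEB EB (b p₀)
  have heQ : p₀.proj ∈ eQ.baseSet := FiberBundle.mem_baseSet_trivializationAt FQ Q p₀.proj
  have hqe := ((eQ.contMDiffAt_iff (eQ.mem_source.2 heQ)).1 hq).2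
  have hcoord := (hK.contMDiffAt_coord he heQ).comp p₀ hb
  have hinv := (hK.isInvertible_coord he heQ).contDiffAt_map_inverse.contMDiffAt.comp p₀ hcoord
  refine (e.contMDiffAt_iff (e.mem_source.2 he)).2 ⟨hb, ?_⟩
  have hvec := hqe.prodMk_space (contMDiffAt_const (c := (0 : FQ →L[ℝ] ℝ)))
  refine (hinv.clm_apply hvec).congr_of_eventuallyEq ?_
  filter_upwards [hb.continuousAt.eventually_mem (e.open_baseSet.mem_nhds he),
    (FiberBundle.continuous_proj _ _).continuousAt.eventually_mem
      (eQ.open_baseSet.mem_nhds heQ)] with p hp hpQ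
  have h := (hK.isInvertible_coord hp hpQ).inverse_apply_self (e ⟨b p, hK.lift (b p) p.snd.1⟩).2
  rw [hK.coord_apply_lift hp hpQ] at h
  exact h.symm

/-- The linear splitting that is annihilated by a core pairing. -/
def splitting (hK : g.IsCorePairing K) : LinearSplitting D :=
  .ofLift hK.lift hK.fibQ_lift hK.contMDiff_lift hK.lift_addQ hK.lift_smulQ

theorem splitting_lift (hK : g.IsCorePairing K) (b : TotalSpace FB B) (q : Q b.proj) :
    hK.splitting.lift b q = hK.lift b q :=
  (TotalSpace.mk_inj.1 (hK.splitting.val_eq_mk q b.snd)).symm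

end IsCorePairing

end LinearMetric

/-! ### Existence of core pairings -/

namespace DoubleVectorBundle

variable (D : DoubleVectorBundle EM FQ Q FB B FEQ EQ FEB EB)

/-- The restriction of the scalar multiplication `t ·_Q` to a fibre of `𝔼 → B`. -/
def fibSmulQ (t : ℝ) (b : TotalSpace FB B) : EB b →ₗ[ℝ] EB (fsmul t b) where
  toFun x := (exists_eq_mk_of_proj_eq (D.proj_smulQ t ⟨b, x⟩)).choose
  map_add' x y := by
    have h : D.smulQ t _ = fadd (D.smulQ t _) (D.smulQ t _) := D.smulQ_addB t ⟨b, x⟩ ⟨b, y⟩ rfl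
    rw [fadd_mk, (exists_eq_mk_of_proj_eq (D.proj_smulQ t ⟨b, x⟩)).choose_spec,
      (exists_eq_mk_of_proj_eq (D.proj_smulQ t ⟨b, y⟩)).choose_spec,
      (exists_eq_mk_of_proj_eq (D.proj_smulQ t ⟨b, x + y⟩)).choose_spec, fadd_mk] at h
    exact TotalSpace.mk_inj.1 h
  map_smul' s x := by
    have h : fsmul s (D.smulQ t ⟨b, x⟩) = D.smulQ t ⟨b, s • x⟩ := D.smulB_smulQ t s ⟨b, x⟩
    rw [(exists_eq_mk_of_proj_eq (D.proj_smulQ t ⟨b, x⟩)).choose_spec,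
      (exists_eq_mk_of_proj_eq (D.proj_smulQ t ⟨b, s • x⟩)).choose_spec, fsmul_mk] at h
    exact (TotalSpace.mk_inj.1 h).symm

theorem smulQ_mk (t : ℝ) (b : TotalSpace FB B) (x : EB b) :
    D.smulQ t ⟨b, x⟩ = ⟨fsmul t b, D.fibSmulQ t b x⟩ :=
  (exists_eq_mk_of_proj_eq (D.proj_smulQ t ⟨b, x⟩)).choose_spec

theorem smulQ_zeroB (t : ℝ) {m : M} (b : B m) : D.smulQ t (D.zeroB b) = D.zeroB (t • b) := by
  rw [zeroB, smulQ_mk, map_zero]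
  rfl

theorem smulQ_addQ (t : ℝ) {d d' : TotalSpace FEB EB} {q : TotalSpace FQ Q}
    (h : D.projQ d = q) (h' : D.projQ d' = q) :
    D.smulQ t (D.addQ d d') = D.addQ (D.smulQ t d) (D.smulQ t d') := by
  obtain ⟨u, rfl⟩ := D.exists_eq_flip_symm h
  obtain ⟨v, rfl⟩ := D.exists_eq_flip_symm h'
  simp only [addQ_flip_symm, smulQ_flip_symm, smul_add]

theorem isCore_smulQ (t : ℝ) {m : M} {c : TotalSpace FEB EB} (hc : D.IsCore m c) :
    D.IsCore m (D.smulQ t c) := by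
  obtain ⟨c, rfl⟩ := exists_eq_mk_of_proj_eq hc.2
  refine ⟨(D.projQ_smulQ t _).trans hc.1, ?_⟩
  rw [smulQ_mk]
  exact congrArg (TotalSpace.mk m) (smul_zero t)

/-- Transport of the zeros of `𝔼 → Q` over `m` to the fibre of `𝔼 → B` over `b`, along a
trivialization `e` of `𝔼 → B`. -/
def transportZero (e : Trivialization FEB (π FEB EB)) [e.IsLinear ℝ] (m : M)
    (b : TotalSpace FB B) : Q m →ₗ[ℝ] EB b :=
  e.symmₗ ℝ b ∘ₗ e.linearMapAt ℝ ⟨m, 0⟩ ∘ₗ D.fibZeroQ m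

section

variable {e : Trivialization FEB (π FEB EB)} [e.IsLinear ℝ] {m : M}
  (hm : (⟨m, 0⟩ : TotalSpace FB B) ∈ e.baseSet)
include hm

theorem transportZero_apply {b : TotalSpace FB B} (hb : b ∈ e.baseSet) (q : Q m) :
    D.transportZero e m b q = e.symm b (e (D.zeroQ q)).2 := by
  simp [transportZero, D.zeroQ_eq_mk, hm, hb]

theorem transportZero_zero (q : Q m) : D.transportZero e m ⟨m, 0⟩ q = D.fibZeroQ m q := by
  rw [D.transportZero_apply hm hm, D.zeroQ_eq_mk, e.symm_apply_apply_mk hm]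

end

section Smoothness

variable {EX : Type*} [NormedAddCommGroup EX] [NormedSpace ℝ EX]
  {HX : Type*} [TopologicalSpace HX] {J : ModelWithCorners ℝ EX HX}
  {X : Type*} [TopologicalSpace X] [ChartedSpace HX X] {x₀ : X}
  [VectorBundle ℝ FEQ EQ]

theorem contMDiffAt_smulQ {t : X → ℝ} {d : X → TotalSpace FEB EB}
    (ht : ContMDiffAt J 𝓘(ℝ, ℝ) ∞ t x₀)
    (hd : ContMDiffAt J ((𝓘(ℝ, EM).prod 𝓘(ℝ, FB)).prod 𝓘(ℝ, FEB)) ∞ d x₀) :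
    ContMDiffAt J ((𝓘(ℝ, EM).prod 𝓘(ℝ, FB)).prod 𝓘(ℝ, FEB)) ∞
      (fun x => D.smulQ (t x) (d x)) x₀ :=
  D.flip.symm.contMDiff.contMDiffAt.comp x₀
    (contMDiffAt_fsmul ht (D.flip.contMDiff.contMDiffAt.comp x₀ hd))

theorem contMDiffAt_zeroQ {q : X → TotalSpace FQ Q}
    (hq : ContMDiffAt J (𝓘(ℝ, EM).prod 𝓘(ℝ, FQ)) ∞ q x₀) :
    ContMDiffAt J ((𝓘(ℝ, EM).prod 𝓘(ℝ, FB)).prod 𝓘(ℝ, FEB)) ∞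
      (fun x => D.zeroQ (q x).snd) x₀ :=
  D.flip.symm.contMDiff.contMDiffAt.comp x₀
    ((contMDiff_zeroSection ℝ EQ).contMDiffAt.comp x₀ hq)

variable [VectorBundle ℝ FEB EB] [ContMDiffVectorBundle ∞ FEB EB (𝓘(ℝ, EM).prod 𝓘(ℝ, FB))]
  {e : Trivialization FEB (π FEB EB)} [MemTrivializationAtlas e]

theorem contMDiffAt_transportZero [VectorBundle ℝ FB B]
    {q : X → TotalSpace FQ Q} {b : X → TotalSpace FB B}
    (hq : ContMDiffAt J (𝓘(ℝ, EM).prod 𝓘(ℝ, FQ)) ∞ q x₀)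
    (hb : ContMDiffAt J (𝓘(ℝ, EM).prod 𝓘(ℝ, FB)) ∞ b x₀)
    (hqe : (⟨(q x₀).proj, 0⟩ : TotalSpace FB B) ∈ e.baseSet) (hbe : b x₀ ∈ e.baseSet) :
    ContMDiffAt J ((𝓘(ℝ, EM).prod 𝓘(ℝ, FB)).prod 𝓘(ℝ, FEB)) ∞
      (fun x => (⟨b x, D.transportZero e (q x).proj (b x) (q x).snd⟩ : TotalSpace FEB EB)) x₀ := by
  have hz : D.zeroQ (q x₀).snd ∈ e.source := by
    rwa [e.mem_source, D.proj_zeroQ]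
  have hcoord := ((e.contMDiffAt_iff (f := fun x => D.zeroQ (q x).snd) hz).1
    (D.contMDiffAt_zeroQ hq)).2
  have hzero : ContMDiffAt J (𝓘(ℝ, EM).prod 𝓘(ℝ, FB)) ∞
      (fun x => (⟨(q x).proj, 0⟩ : TotalSpace FB B)) x₀ :=
    (contMDiff_zeroSection ℝ B).contMDiffAt.comp x₀ ((contMDiff_proj Q).contMDiffAt.comp x₀ hq)
  refine (contMDiffAt_mk_symm e hb hcoord hbe).congr_of_eventuallyEq ?_
  filter_upwards [hzero.continuousAt.eventually_mem (e.open_baseSet.mem_nhds hqe),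
    hb.continuousAt.eventually_mem (e.open_baseSet.mem_nhds hbe)] with x hqx hbx
  rw [D.transportZero_apply hqx hbx]

end Smoothness

end DoubleVectorBundle

namespace LinearMetric

variable {D : DoubleVectorBundle EM FQ Q FB B FEQ EQ FEB EB} (g : LinearMetric D)

theorem exists_form_fibSmulQ {m : M} {b : B m} {x : EB ⟨m, b⟩} (hx : D.fibQ ⟨m, b⟩ x = 0) :
    ∃ c : EB ⟨m, 0⟩,
      (∀ y, g.form ⟨m, b⟩ x y = g.form ⟨m, 0⟩ (D.fibZeroQ m (D.fibQ ⟨m, b⟩ y)) c) ∧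
      ∀ (t : ℝ) (y : EB ⟨m, t • b⟩), g.form ⟨m, t • b⟩ (D.fibSmulQ t ⟨m, b⟩ x) y =
        t * g.form ⟨m, 0⟩ (D.fibZeroQ m (D.fibQ ⟨m, t • b⟩ y)) c := by
  obtain ⟨c, hc, hxc, hform⟩ := g.exists_core hx
  obtain ⟨c, rfl⟩ := exists_eq_mk_of_proj_eq hc.2
  refine ⟨c, fun y => ?_, fun t y => ?_⟩
  · rw [hform, D.zeroQ_eq_mk, pair_mk]
  · have hmk := D.smulQ_mk t ⟨m, b⟩ x
    rw [hxc, D.smulQ_addQ t (D.projQ_zeroB b) hc.1, D.smulQ_zeroB] at hmk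
    have h := g.linear_smul t (D.zeroQ (D.fibQ ⟨m, t • b⟩ y)) ⟨⟨m, 0⟩, c⟩ (D.proj_zeroQ _)
    have hpair := g.pair_zeroB_addQ_core (D.isCore_smulQ t hc) y
    rw [hmk] at hpair
    rw [D.smulQ_zeroQ, D.zeroQ_eq_mk, evalForm_mk] at h
    rw [← h, ← D.zeroQ_eq_mk]
    exact (g.pair_mk ..).symm.trans hpair

/-- The pairing with the transported zero `0_q` of `𝔼 → Q`. -/
def zeroPairing (e : Trivialization FEB (π FEB EB)) [e.IsLinear ℝ] (q : TotalSpace FQ Q)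
    (d : TotalSpace FEB EB) : ℝ :=
  g.form d.proj d.snd (D.transportZero e q.proj d.proj q.snd)

/-- The derivative of `zeroPairing` along the homotheties `t ·_Q d`, as `t → 0`. -/
def derivPairing (e : Trivialization FEB (π FEB EB)) [e.IsLinear ℝ] (d : TotalSpace FEB EB)
    (q : TotalSpace FQ Q) : ℝ :=
  deriv (fun t : ℝ => g.zeroPairing e q (D.smulQ t d)) 0

theorem zeroPairing_smulQ_mk (e : Trivialization FEB (π FEB EB)) [e.IsLinear ℝ]
    (q : TotalSpace FQ Q) (t : ℝ) (b : TotalSpace FB B) (x : EB b) :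
    g.zeroPairing e q (D.smulQ t ⟨b, x⟩) =
      g.form (fsmul t b) (D.fibSmulQ t b x) (D.transportZero e q.proj (fsmul t b) q.snd) := by
  rw [D.smulQ_mk]
  rfl

section Smoothness

variable {EX : Type*} [NormedAddCommGroup EX] [NormedSpace ℝ EX]
  {HX : Type*} [TopologicalSpace HX] {J : ModelWithCorners ℝ EX HX}
  {X : Type*} [TopologicalSpace X] [ChartedSpace HX X] {x₀ : X}

theorem contMDiffAt_form {b : X → TotalSpace FB B} {x y : ∀ p, EB (b p)}
    (hx : ContMDiffAt J ((𝓘(ℝ, EM).prod 𝓘(ℝ, FB)).prod 𝓘(ℝ, FEB)) ∞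
      (fun p => (⟨b p, x p⟩ : TotalSpace FEB EB)) x₀)
    (hy : ContMDiffAt J ((𝓘(ℝ, EM).prod 𝓘(ℝ, FB)).prod 𝓘(ℝ, FEB)) ∞
      (fun p => (⟨b p, y p⟩ : TotalSpace FEB EB)) x₀) :
    ContMDiffAt J 𝓘(ℝ, ℝ) ∞ (fun p => g.form (b p) (x p) (y p)) x₀ :=
  g.smooth.contMDiffAt.comp x₀ (contMDiffAt_mk_prod_iff.2 ⟨hx, hy⟩)

variable [VectorBundle ℝ FEQ EQ] [VectorBundle ℝ FB B]
  [VectorBundle ℝ FEB EB] [ContMDiffVectorBundle ∞ FEB EB (𝓘(ℝ, EM).prod 𝓘(ℝ, FB))]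
  {e : Trivialization FEB (π FEB EB)} [MemTrivializationAtlas e]
  {d : X → TotalSpace FEB EB} {q : X → TotalSpace FQ Q}
  (hd : ContMDiffAt J ((𝓘(ℝ, EM).prod 𝓘(ℝ, FB)).prod 𝓘(ℝ, FEB)) ∞ d x₀)
  (hq : ContMDiffAt J (𝓘(ℝ, EM).prod 𝓘(ℝ, FQ)) ∞ q x₀)
  (hqe : (⟨(q x₀).proj, 0⟩ : TotalSpace FB B) ∈ e.baseSet)
include hd hq hqe

theorem contMDiffAt_zeroPairing (hde : (d x₀).proj ∈ e.baseSet) :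
    ContMDiffAt J 𝓘(ℝ, ℝ) ∞ (fun x => g.zeroPairing e (q x) (d x)) x₀ :=
  g.contMDiffAt_form hd
    (D.contMDiffAt_transportZero hq ((contMDiff_proj EB).contMDiffAt.comp x₀ hd) hqe hde)

variable (h : (d x₀).proj.proj = (q x₀).proj)
include h

theorem contMDiffAt_zeroPairing_smulQ {t : X → ℝ} (ht : ContMDiffAt J 𝓘(ℝ, ℝ) ∞ t x₀)
    (ht₀ : t x₀ = 0) :
    ContMDiffAt J 𝓘(ℝ, ℝ) ∞ (fun x => g.zeroPairing e (q x) (D.smulQ (t x) (d x))) x₀ := by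
  refine g.contMDiffAt_zeroPairing (D.contMDiffAt_smulQ ht hd) hq hqe ?_
  rwa [D.proj_smulQ, ht₀, fsmul, zero_smul, h]

theorem contMDiffAt_derivPairing [IsManifold J ∞ X] :
    ContMDiffAt J 𝓘(ℝ, ℝ) ∞ (fun x => g.derivPairing e (d x) (q x)) x₀ := by
  have hf : ContMDiffAt (J.prod 𝓘(ℝ, ℝ)) 𝓘(ℝ, ℝ) ∞
      (Function.uncurry fun (x : X) (t : ℝ) => g.zeroPairing e (q x) (D.smulQ t (d x)))
      (x₀, 0) :=
    g.contMDiffAt_zeroPairing_smulQ (x₀ := (x₀, (0 : ℝ))) (t := Prod.snd)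
      (d := fun p => d p.1) (q := fun p => q p.1) (hd.comp (x₀, (0 : ℝ)) contMDiffAt_fst)
      (hq.comp (x₀, (0 : ℝ)) contMDiffAt_fst) hqe h contMDiffAt_snd rfl
  have hderiv := ContMDiffAt.mfderiv_apply (m := ∞) _ (fun _ => (0 : ℝ)) id (fun _ => (1 : ℝ)) hf
    contMDiffAt_const contMDiffAt_id contMDiffAt_const le_rfl
  refine hderiv.congr_of_eventuallyEq (.of_forall fun x => ?_)
  simp only [inTangentCoordinates_model_space, mfderiv_eq_fderiv]
  exact (fderiv_apply_one_eq_deriv ..).symm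

end Smoothness

section LocalPairing

variable [VectorBundle ℝ FEQ EQ] [VectorBundle ℝ FB B]
  [VectorBundle ℝ FEB EB] [ContMDiffVectorBundle ∞ FEB EB (𝓘(ℝ, EM).prod 𝓘(ℝ, FB))]
  (e : Trivialization FEB (π FEB EB)) [MemTrivializationAtlas e]

variable {e} in
theorem differentiableAt_zeroPairing_smulQ {d : TotalSpace FEB EB} {q : TotalSpace FQ Q}
    (hqe : (⟨q.proj, 0⟩ : TotalSpace FB B) ∈ e.baseSet) (h : d.proj.proj = q.proj) :
    DifferentiableAt ℝ (fun t : ℝ => g.zeroPairing e q (D.smulQ t d)) 0 :=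
  (g.contMDiffAt_zeroPairing_smulQ (t := id) (d := fun _ => d) (q := fun _ => q)
    contMDiffAt_const contMDiffAt_const hqe h contMDiffAt_id rfl).contDiffAt.differentiableAt
      (by simp)

open Classical in
/-- The core pairing `derivPairing` over the set of all `m` with `0_m ∈ B` in the base of the
trivialization `e`, extended by the junk value `0`. -/
def localPairing (b : TotalSpace FB B) : EB b →ₗ[ℝ] Q b.proj →ₗ[ℝ] ℝ :=
  if hb : (⟨b.proj, 0⟩ : TotalSpace FB B) ∈ e.baseSet then
    LinearMap.mk₂ ℝ (fun x q => g.derivPairing e ⟨b, x⟩ ⟨b.proj, q⟩)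
      (fun x x' q => by
        rw [derivPairing, derivPairing, derivPairing,
          ← deriv_fun_add (g.differentiableAt_zeroPairing_smulQ hb rfl)
            (g.differentiableAt_zeroPairing_smulQ hb rfl)]
        simp only [zeroPairing_smulQ_mk, map_add, LinearMap.add_apply])
      (fun s x q => by
        rw [derivPairing, derivPairing, smul_eq_mul, ← deriv_const_mul_field]
        simp only [zeroPairing_smulQ_mk, map_smul, LinearMap.smul_apply, smul_eq_mul])
      (fun x q q' => by
        rw [derivPairing, derivPairing, derivPairing,
          ← deriv_fun_add (g.differentiableAt_zeroPairing_smulQ hb rfl)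
            (g.differentiableAt_zeroPairing_smulQ hb rfl)]
        simp only [zeroPairing_smulQ_mk, map_add])
      (fun s x q => by
        rw [derivPairing, derivPairing, smul_eq_mul, ← deriv_const_mul_field]
        simp only [zeroPairing_smulQ_mk, map_smul, smul_eq_mul])
  else 0

variable {e} {m : M} (hm : (⟨m, 0⟩ : TotalSpace FB B) ∈ e.baseSet)
include hm

theorem localPairing_apply (b : B m) (x : EB ⟨m, b⟩) (q : Q m) :
    g.localPairing e ⟨m, b⟩ x q = g.derivPairing e ⟨⟨m, b⟩, x⟩ ⟨m, q⟩ := by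
  rw [localPairing, dif_pos hm, LinearMap.mk₂_apply]

theorem exists_linearMap_derivPairing (q q' : Q m) : ∃ ℓ : EQ ⟨m, q⟩ →ₗ[ℝ] ℝ,
    ∀ u, g.derivPairing e (D.flip.symm ⟨⟨m, q⟩, u⟩) ⟨m, q'⟩ = ℓ u := by
  have hzero : (D.flip.symm ⟨⟨m, q⟩, 0⟩).proj = ⟨m, 0⟩ := D.proj_zeroQ q
  have hG : ContMDiffAt ((𝓘(ℝ, EM).prod 𝓘(ℝ, FQ)).prod 𝓘(ℝ, FEQ)) 𝓘(ℝ, ℝ) ∞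
      (fun p => g.zeroPairing e ⟨m, q'⟩ (D.flip.symm p)) (⟨⟨m, q⟩, 0⟩ : TotalSpace FEQ EQ) :=
    g.contMDiffAt_zeroPairing (q := fun _ => ⟨m, q'⟩) D.flip.symm.contMDiff.contMDiffAt
      contMDiffAt_const hm (hzero ▸ hm)
  obtain ⟨ℓ, hℓ⟩ := exists_linearMap_deriv_smul (hG.of_le (by simp))
  refine ⟨ℓ, fun u => ?_⟩
  rw [← hℓ, derivPairing]
  simp only [D.smulQ_flip_symm]

theorem exists_zeroPairing_smulQ_eq_mul {b : B m} {x : EB ⟨m, b⟩} (hx : D.fibQ ⟨m, b⟩ x = 0)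
    (y : EB ⟨m, b⟩) : ∃ f : ℝ → ℝ, DifferentiableAt ℝ f 0 ∧ f 0 = g.form ⟨m, b⟩ x y ∧
      ∀ t, g.zeroPairing e ⟨m, D.fibQ ⟨m, b⟩ y⟩ (D.smulQ t ⟨⟨m, b⟩, x⟩) = t * f t := by
  obtain ⟨c, hform, hsmul⟩ := g.exists_form_fibSmulQ hx
  let q : Q m := D.fibQ ⟨m, b⟩ y
  let z (b : B m) : EB ⟨m, 0⟩ := D.fibZeroQ m (D.fibQ ⟨m, b⟩ (D.transportZero e m ⟨m, b⟩ q))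
  have hb : ContMDiffAt 𝓘(ℝ, ℝ) (𝓘(ℝ, EM).prod 𝓘(ℝ, FB)) ∞
      (fun t : ℝ => fsmul t (⟨m, b⟩ : TotalSpace FB B)) 0 :=
    contMDiffAt_fsmul contMDiffAt_id contMDiffAt_const
  have hz : ContMDiffAt 𝓘(ℝ, ℝ) ((𝓘(ℝ, EM).prod 𝓘(ℝ, FB)).prod 𝓘(ℝ, FEB)) ∞
      (fun t : ℝ => (⟨⟨m, 0⟩, z (t • b)⟩ : TotalSpace FEB EB)) 0 := by
    have htransport := D.contMDiffAt_transportZero (q := fun _ => ⟨m, q⟩) contMDiffAt_const hb hm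
      (by rwa [fsmul_mk, zero_smul])
    exact (D.contMDiffAt_zeroQ (D.contMDiffAt_projQ htransport)).congr_of_eventuallyEq
      (.of_forall fun t => (D.zeroQ_eq_mk _).symm.trans
        (congrArg (fun p : TotalSpace FQ Q => D.zeroQ p.snd) (D.projQ_mk ..).symm))
  refine ⟨fun t => g.form ⟨m, 0⟩ (z (t • b)) c, ?_, ?_, fun t => ?_⟩
  · exact (g.contMDiffAt_form (b := fun _ => ⟨m, 0⟩) hz
      contMDiffAt_const).contDiffAt.differentiableAt (by simp)
  · simp only [z]
    rw [zero_smul, D.transportZero_zero hm, D.fibQ_fibZeroQ, hform]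
  · rw [g.zeroPairing_smulQ_mk]
    exact hsmul t _

theorem derivPairing_of_fibQ_eq_zero {b : B m} {x : EB ⟨m, b⟩} (hx : D.fibQ ⟨m, b⟩ x = 0)
    (y : EB ⟨m, b⟩) :
    g.derivPairing e ⟨⟨m, b⟩, x⟩ ⟨m, D.fibQ ⟨m, b⟩ y⟩ = g.form ⟨m, b⟩ x y := by
  obtain ⟨f, hdiff, hf, hzero⟩ := g.exists_zeroPairing_smulQ_eq_mul hm hx y
  have hderiv := ((hasDerivAt_id (0 : ℝ)).fun_mul hdiff.hasDerivAt).deriv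
  simp only [id] at hderiv
  rw [derivPairing, funext hzero, hderiv, zero_mul, add_zero, one_mul, hf]

theorem isCorePairingAt_localPairing : g.IsCorePairingAt (g.localPairing e) m where
  addQ {b b' x x' y} q hq hy := by
    obtain ⟨u, hu⟩ := D.exists_eq_flip_symm (D.projQ_mk ⟨m, b⟩ x)
    obtain ⟨u', hu'⟩ := D.exists_eq_flip_symm ((D.projQ_eq_projQ hq).symm.trans (D.projQ_mk _ x))
    obtain ⟨ℓ, hℓ⟩ := g.exists_linearMap_derivPairing hm (D.fibQ ⟨m, b⟩ x) q
    rw [hu, hu', D.addQ_flip_symm] at hy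
    rw [g.localPairing_apply hm, g.localPairing_apply hm, g.localPairing_apply hm, ← hy, hu, hu',
      hℓ, hℓ, hℓ, map_add]
  smulQ {b t x y} q hy := by
    obtain ⟨u, hu⟩ := D.exists_eq_flip_symm (D.projQ_mk ⟨m, b⟩ x)
    obtain ⟨ℓ, hℓ⟩ := g.exists_linearMap_derivPairing hm (D.fibQ ⟨m, b⟩ x) q
    rw [hu, D.smulQ_flip_symm] at hy
    rw [g.localPairing_apply hm, g.localPairing_apply hm, ← hy, hu, hℓ, hℓ, map_smul, smul_eq_mul]
  core hx y := (g.localPairing_apply hm ..).trans (g.derivPairing_of_fibQ_eq_zero hm hx y)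

omit hm in
theorem smoothPairingAt_localPairing [IsManifold 𝓘(ℝ, EM) ∞ M]
    [ContMDiffVectorBundle ∞ FB B 𝓘(ℝ, EM)] {d₀ : TotalSpace FEB EB}
    (hd₀ : (⟨d₀.proj.proj, 0⟩ : TotalSpace FB B) ∈ e.baseSet) :
    SmoothPairingAt EM FQ (g.localPairing e) d₀ := by
  intro s hs
  have hproj : ContMDiffAt ((𝓘(ℝ, EM).prod 𝓘(ℝ, FB)).prod 𝓘(ℝ, FEB)) 𝓘(ℝ, EM) ∞
      (fun d : TotalSpace FEB EB => d.proj.proj) d₀ :=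
    (contMDiff_proj B).contMDiffAt.comp d₀ (contMDiff_proj EB d₀)
  have hzero : ContMDiffAt ((𝓘(ℝ, EM).prod 𝓘(ℝ, FB)).prod 𝓘(ℝ, FEB)) (𝓘(ℝ, EM).prod 𝓘(ℝ, FB)) ∞
      (fun d : TotalSpace FEB EB => (⟨d.proj.proj, 0⟩ : TotalSpace FB B)) d₀ :=
    (contMDiff_zeroSection ℝ B).contMDiffAt.comp d₀ hproj
  refine (g.contMDiffAt_derivPairing (d := id) contMDiffAt_id (hs.comp d₀ hproj) hd₀
    rfl).congr_of_eventuallyEq ?_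
  filter_upwards [hzero.continuousAt.eventually_mem (e.open_baseSet.mem_nhds hd₀)] with d hd
  exact g.localPairing_apply hd _ _ _

end LocalPairing

section Gluing

variable {g} {ι : Type*} {K : ι → ∀ b : TotalSpace FB B, EB b →ₗ[ℝ] Q b.proj →ₗ[ℝ] ℝ}

theorem IsCorePairingAt.sum {s : Finset ι} {c : ι → ℝ} (hc : ∑ i ∈ s, c i = 1) {m : M}
    (hK : ∀ i ∈ s, g.IsCorePairingAt (K i) m) :
    g.IsCorePairingAt (fun b => ∑ i ∈ s, c i • K i b) m where
  addQ {b b' x x' y} q hq hy := by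
    simp only [LinearMap.sum_apply, LinearMap.smul_apply, ← Finset.sum_add_distrib]
    exact Finset.sum_congr rfl fun i hi => by rw [(hK i hi).addQ q hq hy, smul_add]
  smulQ {b t x y} q hy := by
    simp only [LinearMap.sum_apply, LinearMap.smul_apply, Finset.mul_sum]
    exact Finset.sum_congr rfl fun i hi => by rw [(hK i hi).smulQ q hy, mul_smul_comm]
  core {b x} hx y := by
    simp only [LinearMap.sum_apply, LinearMap.smul_apply, smul_eq_mul]
    rw [← one_mul (g.form _ _ _), ← hc, Finset.sum_mul]
    exact Finset.sum_congr rfl fun i hi => by rw [(hK i hi).core hx]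

variable (ρ : SmoothPartitionOfUnity ι 𝓘(ℝ, EM) M)

omit [∀ m, AddCommGroup (B m)] [∀ m, Module ℝ (B m)] in
theorem SmoothPairingAt.sum {d₀ : TotalSpace FEB EB}
    (hK : ∀ i, d₀.proj.proj ∈ tsupport (ρ i) → SmoothPairingAt EM FQ (K i) d₀) :
    SmoothPairingAt EM FQ
      (fun b => ∑ i ∈ ρ.finsupport b.proj, ρ i b.proj • K i b) d₀ := by
  intro s hs
  have hproj : ContMDiff ((𝓘(ℝ, EM).prod 𝓘(ℝ, FB)).prod 𝓘(ℝ, FEB)) 𝓘(ℝ, EM) ∞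
      (fun d : TotalSpace FEB EB => d.proj.proj) :=
    (contMDiff_proj B).comp (contMDiff_proj EB)
  have hsum : ContMDiffAt ((𝓘(ℝ, EM).prod 𝓘(ℝ, FB)).prod 𝓘(ℝ, FEB)) 𝓘(ℝ, ℝ) ∞
      (fun d : TotalSpace FEB EB => ∑ᶠ i, ρ i d.proj.proj • K i d.proj d.snd (s d.proj.proj))
      d₀ := by
    refine contMDiffAt_finsum ?_ fun i => ?_
    · refine (ρ.locallyFinite.preimage_continuous hproj.continuous).subset fun i d hd hd' => hd ?_
      simp only [show ρ i d.proj.proj = 0 from hd', zero_smul]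
    · by_cases hi : d₀.proj.proj ∈ tsupport (ρ i)
      · exact ((ρ i).contMDiff.contMDiffAt.comp d₀ (hproj d₀)).smul (hK i hi s hs)
      · refine (contMDiffAt_const (c := (0 : ℝ))).congr_of_eventuallyEq ?_
        filter_upwards [hproj.continuous.continuousAt.eventually_mem
          ((isClosed_tsupport (ρ i)).isOpen_compl.mem_nhds hi)] with d hd
        rw [image_eq_zero_of_notMem_tsupport hd, zero_smul]
  refine hsum.congr_of_eventuallyEq (.of_forall fun d => ?_)
  simp only [LinearMap.sum_apply, LinearMap.smul_apply]
  exact ρ.sum_finsupport_smul_eq_finsum d.proj.proj fun i _ => K i d.proj d.snd (s d.proj.proj)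

theorem isCorePairing_sum {U : ι → Set M} (hρ : ρ.IsSubordinate U)
    (hK : ∀ i, ∀ m ∈ U i, g.IsCorePairingAt (K i) m)
    (hs : ∀ i, ∀ d₀ : TotalSpace FEB EB, d₀.proj.proj ∈ U i → SmoothPairingAt EM FQ (K i) d₀) :
    g.IsCorePairing (fun b => ∑ i ∈ ρ.finsupport b.proj, ρ i b.proj • K i b) where
  isCorePairingAt m := by
    have h := IsCorePairingAt.sum (ρ.sum_finsupport m (Set.mem_univ m)) fun i hi =>
      hK i m (hρ i (subset_closure ((ρ.mem_finsupport m).1 hi)))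
    exact ⟨h.addQ, h.smulQ, h.core⟩
  smoothPairingAt d₀ := .sum ρ fun i hi => hs i d₀ (hρ i hi)

end Gluing

theorem exists_isCorePairing [FiniteDimensional ℝ EM] [IsManifold 𝓘(ℝ, EM) ∞ M] [T2Space M]
    [SigmaCompactSpace M] [VectorBundle ℝ FB B] [ContMDiffVectorBundle ∞ FB B 𝓘(ℝ, EM)]
    [VectorBundle ℝ FEQ EQ] [VectorBundle ℝ FEB EB]
    [ContMDiffVectorBundle ∞ FEB EB (𝓘(ℝ, EM).prod 𝓘(ℝ, FB))] : ∃ K, g.IsCorePairing K := by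
  let e (m : M) : Trivialization FEB (π FEB EB) := trivializationAt FEB EB ⟨m, 0⟩
  let U (m : M) : Set M := {m' | (⟨m', 0⟩ : TotalSpace FB B) ∈ (e m).baseSet}
  have hU : ∀ m, IsOpen (U m) := fun m => (e m).open_baseSet.preimage
    (contMDiff_zeroSection (IB := 𝓘(ℝ, EM)) (n := ∞) (F := FB) ℝ B).continuous
  obtain ⟨ρ, hρ⟩ := SmoothPartitionOfUnity.exists_isSubordinate 𝓘(ℝ, EM) isClosed_univ U hU
    fun m _ => Set.mem_iUnion.2 ⟨m, FiberBundle.mem_baseSet_trivializationAt FEB EB ⟨m, 0⟩⟩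
  exact ⟨_, isCorePairing_sum ρ hρ (K := fun m => g.localPairing (e m))
    (fun m _ hm' => g.isCorePairingAt_localPairing hm')
    fun m _ hd₀ => g.smoothPairingAt_localPairing hd₀⟩

end LinearMetric

/-! ### Lagrangian splittings -/

theorem LinearSplitting.contMDiffAt_lift {D : DoubleVectorBundle EM FQ Q FB B FEQ EQ FEB EB}
    (S : LinearSplitting D) {EX : Type*} [NormedAddCommGroup EX] [NormedSpace ℝ EX]
    {HX : Type*} [TopologicalSpace HX] {J : ModelWithCorners ℝ EX HX}
    {X : Type*} [TopologicalSpace X] [ChartedSpace HX X] {x₀ : X}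
    {m : X → M} {q : ∀ x, Q (m x)} {b : ∀ x, B (m x)}
    (hq : ContMDiffAt J (𝓘(ℝ, EM).prod 𝓘(ℝ, FQ)) ∞ (fun x => (⟨m x, q x⟩ : TotalSpace FQ Q)) x₀)
    (hb : ContMDiffAt J (𝓘(ℝ, EM).prod 𝓘(ℝ, FB)) ∞
      (fun x => (⟨m x, b x⟩ : TotalSpace FB B)) x₀) :
    ContMDiffAt J ((𝓘(ℝ, EM).prod 𝓘(ℝ, FB)).prod 𝓘(ℝ, FEB)) ∞
      (fun x => (⟨⟨m x, b x⟩, S.lift ⟨m x, b x⟩ (q x)⟩ : TotalSpace FEB EB)) x₀ :=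
  (S.smooth.contMDiffAt.comp x₀ (contMDiffAt_mk_prod_iff.2 ⟨hq, hb⟩)).congr_of_eventuallyEq
    (.of_forall fun x => (S.val_eq_mk (q x) (b x)).symm)

set_option maxSynthPendingDepth 3 in
/-- The difference of two smooth sections of `Q* ⊗ Q* ⊗ B*`. -/
def SmoothTensor.sub (φ ψ : SmoothTensor EM FQ Q FB B) : SmoothTensor EM FQ Q FB B where
  toFun m := φ.toFun m - ψ.toFun m
  smooth := φ.smooth.sub ψ.smooth

namespace LinearMetric

variable {D : DoubleVectorBundle EM FQ Q FB B FEQ EQ FEB EB} (g : LinearMetric D)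
  (S S' S₁ S₂ : LinearSplitting D)

/-- The section `(q, q') ↦ ⟨Σ(q, ·), Σ'(q', ·)⟩` of `Q* ⊗ Q* ⊗ B*` defined by two linear
splittings. -/
def tensor : SmoothTensor EM FQ Q FB B where
  toFun m := LinearMap.mk₂ ℝ
    (fun q q' =>
      { toFun b := g.form ⟨m, b⟩ (S.lift ⟨m, b⟩ q) (S'.lift ⟨m, b⟩ q')
        map_add' b b' := g.form_addQ (by rw [S.fibQ_lift, S.fibQ_lift])
          (by rw [S'.fibQ_lift, S'.fibQ_lift]) (S.lift_addQ q b b') (S'.lift_addQ q' b b')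
        map_smul' t b := g.form_smulQ (S.lift_smulQ t q b) (S'.lift_smulQ t q' b) })
    (fun q₁ q₂ q' => LinearMap.ext fun b => by simp)
    (fun t q q' => LinearMap.ext fun b => by simp)
    (fun q q₁ q₂ => LinearMap.ext fun b => by simp)
    (fun t q q' => LinearMap.ext fun b => by simp)
  smooth p := by
    obtain ⟨hq, hp⟩ := contMDiffAt_mk_prod_iff.1
      (contMDiffAt_id (I := 𝓘(ℝ, EM).prod 𝓘(ℝ, FQ × (FQ × FB))) (n := ∞) (x := p))
    obtain ⟨hq', hb⟩ := contMDiffAt_mk_prod_iff.1 hp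
    exact g.contMDiffAt_form (S.contMDiffAt_lift hq hb) (S'.contMDiffAt_lift hq' hb)

theorem tensor_apply (m : M) (q q' : Q m) (b : B m) :
    (g.tensor S S').toFun m q q' b = g.form ⟨m, b⟩ (S.lift ⟨m, b⟩ q) (S'.lift ⟨m, b⟩ q') :=
  rfl

theorem pair_val (m : M) (q q' : Q m) (b : B m) :
    g.pair (S.val q b) (S.val q' b) = (g.tensor S S).toFun m q q' b := by
  rw [S.val_eq_mk, S.val_eq_mk, pair_mk, tensor_apply]

theorem isSymmetric_tensor_self : (g.tensor S S).IsSymmetric := fun m q q' b => by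
  rw [tensor_apply, tensor_apply, g.symm]

theorem exists_differBy : ∃ φ, g.DifferBy S₁ S₂ 1 φ :=
  ⟨(g.tensor S₁ S₁).sub (g.tensor S₂ S₁), (g.differBy_iff S₁).2 fun m q q' b => by
    rw [one_mul, map_sub]
    rfl⟩

variable {g S₁ S₂} in
theorem DifferBy.form_lift {s : ℝ} {φ : SmoothTensor EM FQ Q FB B} (h : g.DifferBy S₁ S₂ s φ)
    (m : M) (q q' : Q m) (b : B m) :
    g.form ⟨m, b⟩ (S₂.lift ⟨m, b⟩ q) (S₂.lift ⟨m, b⟩ q') =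
      g.form ⟨m, b⟩ (S₁.lift ⟨m, b⟩ q) (S₁.lift ⟨m, b⟩ q') -
        s * (φ.toFun m q q' b + φ.toFun m q' q b) := by
  have h₁ := (g.differBy_iff S₁).1 h m q q' b
  have h₂ := (g.differBy_iff S₂).1 h m q' q b
  simp only [map_sub, LinearMap.sub_apply] at h₁ h₂
  rw [g.symm _ _ (S₂.lift ⟨m, b⟩ q), g.symm _ _ (S₂.lift ⟨m, b⟩ q)] at h₂
  linarith

variable {g S₁ S₂} in
theorem IsLagrangian.isLagrangian_iff_isSkew (h₁ : g.IsLagrangian S₁)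
    {φ : SmoothTensor EM FQ Q FB B} (hφ : g.DifferBy S₁ S₂ 1 φ) :
    g.IsLagrangian S₂ ↔ φ.IsSkew := by
  rw [isLagrangian_iff] at h₁ ⊢
  have key (m : M) (q q' : Q m) (b : B m) :
      g.form ⟨m, b⟩ (S₂.lift ⟨m, b⟩ q) (S₂.lift ⟨m, b⟩ q') = 0 ↔
        φ.toFun m q q' b = -φ.toFun m q' q b := by
    rw [hφ.form_lift, h₁, one_mul, zero_sub, neg_eq_zero, add_eq_zero_iff_eq_neg]
  exact ⟨fun h m q q' b => (key m q q' b).1 (h ⟨m, b⟩ q q'),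
    fun h b q q' => (key b.proj q q' b.snd).2 (h b.proj q q' b.snd)⟩

/-- The core pairing `⟨x, Σ(q)⟩ - ½ ⟨Σ(π_Q x), Σ(q)⟩`. Its kernel is the linear splitting that
differs from `Σ` by half of `⟨Σ, Σ⟩`. -/
def symmetrizedPairing (b : TotalSpace FB B) : EB b →ₗ[ℝ] Q b.proj →ₗ[ℝ] ℝ :=
  (g.form b - (1 / 2 : ℝ) • g.form b ∘ₗ S.lift b ∘ₗ D.fibQ b).compl₂ (S.lift b)

theorem symmetrizedPairing_apply (b : TotalSpace FB B) (x : EB b) (q : Q b.proj) :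
    g.symmetrizedPairing S b x q = g.form b x (S.lift b q) -
      1 / 2 * g.form b (S.lift b (D.fibQ b x)) (S.lift b q) :=
  rfl

theorem isCorePairingAt_symmetrizedPairing (m : M) :
    g.IsCorePairingAt (g.symmetrizedPairing S) m where
  addQ {b b' x x' y} q hq hy := by
    have hyq : D.fibQ ⟨m, b + b'⟩ y = D.fibQ ⟨m, b⟩ x := by
      rw [D.fibQ_eq_iff, ← hy]
      exact D.projQ_addQ (D.projQ_mk _ x) ((D.projQ_eq_projQ hq).symm.trans (D.projQ_mk _ x))
    have hS (q : Q m) : D.fibQ ⟨m, b⟩ (S.lift ⟨m, b⟩ q) = D.fibQ ⟨m, b'⟩ (S.lift ⟨m, b'⟩ q) := by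
      rw [S.fibQ_lift, S.fibQ_lift]
    simp only [symmetrizedPairing_apply]
    rw [g.form_addQ hq (hS q) hy (S.lift_addQ q b b'), hyq, ← hq,
      g.form_addQ (hS _) (hS q) (S.lift_addQ _ b b') (S.lift_addQ q b b')]
    ring
  smulQ {b t x y} q hy := by
    have hyq : D.fibQ ⟨m, t • b⟩ y = D.fibQ ⟨m, b⟩ x := by
      rw [D.fibQ_eq_iff, ← hy, D.projQ_smulQ]
      exact D.projQ_mk _ x
    simp only [symmetrizedPairing_apply]
    rw [g.form_smulQ hy (S.lift_smulQ t q b), hyq,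
      g.form_smulQ (S.lift_smulQ t _ b) (S.lift_smulQ t q b)]
    ring
  core {b x} hx y := by
    rw [symmetrizedPairing_apply, hx, map_zero, map_zero, LinearMap.zero_apply, mul_zero, sub_zero]
    exact g.form_congr_of_fibQ_eq hx (S.fibQ_lift _ _)

theorem isCorePairing_symmetrizedPairing : g.IsCorePairing (g.symmetrizedPairing S) where
  isCorePairingAt := g.isCorePairingAt_symmetrizedPairing S
  smoothPairingAt d₀ s hs := by
    have hb : ContMDiffAt ((𝓘(ℝ, EM).prod 𝓘(ℝ, FB)).prod 𝓘(ℝ, FEB)) (𝓘(ℝ, EM).prod 𝓘(ℝ, FB)) ∞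
        (fun d : TotalSpace FEB EB => d.proj) d₀ := contMDiff_proj EB d₀
    have hSs := S.contMDiffAt_lift (m := fun d : TotalSpace FEB EB => d.proj.proj)
      (b := fun d => d.proj.snd) (hs.comp d₀ ((contMDiff_proj B).contMDiffAt.comp d₀ hb)) hb
    have hq : ContMDiffAt ((𝓘(ℝ, EM).prod 𝓘(ℝ, FB)).prod 𝓘(ℝ, FEB)) (𝓘(ℝ, EM).prod 𝓘(ℝ, FQ)) ∞
        (fun d : TotalSpace FEB EB => (⟨d.proj.proj, D.fibQ d.proj d.snd⟩ : TotalSpace FQ Q)) d₀ :=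
      (D.contMDiffAt_projQ contMDiffAt_id).congr_of_eventuallyEq
        (.of_forall fun d => (D.projQ_mk d.proj d.snd).symm)
    have hSq := S.contMDiffAt_lift (m := fun d : TotalSpace FEB EB => d.proj.proj)
      (b := fun d => d.proj.snd) hq hb
    exact (g.contMDiffAt_form (x := fun d => d.snd) contMDiffAt_id hSs).sub
      (contMDiffAt_const.mul (g.contMDiffAt_form hSq hSs))

variable [FiniteDimensional ℝ FQ] [VectorBundle ℝ FQ Q] [ContMDiffVectorBundle ∞ FQ Q 𝓘(ℝ, EM)]
  [FiniteDimensional ℝ FEB] [VectorBundle ℝ FEB EB]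
  [ContMDiffVectorBundle ∞ FEB EB (𝓘(ℝ, EM).prod 𝓘(ℝ, FB))]

theorem exists_isLagrangian_differBy :
    ∃ S' : LinearSplitting D, g.DifferBy S S' (1 / 2) (g.tensor S S) ∧ g.IsLagrangian S' := by
  have hK := g.isCorePairing_symmetrizedPairing S
  have hdiffer : g.DifferBy S hK.splitting (1 / 2) (g.tensor S S) := by
    refine (g.differBy_iff S).2 fun m q q' b => ?_
    have h := LinearMap.congr_fun (hK.apply_lift ⟨m, b⟩ q) q'
    rw [symmetrizedPairing_apply, hK.fibQ_lift, LinearMap.zero_apply, sub_eq_zero] at h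
    rw [hK.splitting_lift, map_sub, LinearMap.sub_apply, h, tensor_apply]
    ring
  refine ⟨hK.splitting, hdiffer, (g.isLagrangian_iff _).2 fun b q q' => ?_⟩
  refine (hdiffer.form_lift b.proj q q' b.snd).trans ?_
  rw [g.isSymmetric_tensor_self S b.proj q' q, tensor_apply]
  ring

end LinearMetric

end DVB

end

theorem proposition3p5_general
    {EM : Type*} [NormedAddCommGroup EM] [NormedSpace ℝ EM] [FiniteDimensional ℝ EM]
    {M : Type*} [TopologicalSpace M] [ChartedSpace EM M] [IsManifold 𝓘(ℝ, EM) ∞ M]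
    [T2Space M] [SigmaCompactSpace M]
    {FQ : Type*} [NormedAddCommGroup FQ] [NormedSpace ℝ FQ] [FiniteDimensional ℝ FQ]
    {Q : M → Type*} [∀ m, AddCommGroup (Q m)] [∀ m, Module ℝ (Q m)]
    [∀ m, TopologicalSpace (Q m)] [TopologicalSpace (TotalSpace FQ Q)]
    [FiberBundle FQ Q] [VectorBundle ℝ FQ Q] [ContMDiffVectorBundle ∞ FQ Q 𝓘(ℝ, EM)]
    {FB : Type*} [NormedAddCommGroup FB] [NormedSpace ℝ FB]
    {B : M → Type*} [∀ m, AddCommGroup (B m)] [∀ m, Module ℝ (B m)]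
    [∀ m, TopologicalSpace (B m)] [TopologicalSpace (TotalSpace FB B)]
    [FiberBundle FB B] [VectorBundle ℝ FB B] [ContMDiffVectorBundle ∞ FB B 𝓘(ℝ, EM)]
    {FEQ : Type*} [NormedAddCommGroup FEQ] [NormedSpace ℝ FEQ]
    {EQ : TotalSpace FQ Q → Type*} [∀ q, AddCommGroup (EQ q)] [∀ q, Module ℝ (EQ q)]
    [∀ q, TopologicalSpace (EQ q)] [TopologicalSpace (TotalSpace FEQ EQ)]
    [FiberBundle FEQ EQ] [VectorBundle ℝ FEQ EQ]
    {FEB : Type*} [NormedAddCommGroup FEB] [NormedSpace ℝ FEB] [FiniteDimensional ℝ FEB]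
    {EB : TotalSpace FB B → Type*} [∀ b, AddCommGroup (EB b)] [∀ b, Module ℝ (EB b)]
    [∀ b, TopologicalSpace (EB b)] [TopologicalSpace (TotalSpace FEB EB)]
    [FiberBundle FEB EB] [VectorBundle ℝ FEB EB]
    [ContMDiffVectorBundle ∞ FEB EB (𝓘(ℝ, EM).prod 𝓘(ℝ, FB))]
    (D : DVB.DoubleVectorBundle EM FQ Q FB B FEQ EQ FEB EB) (g : DVB.LinearMetric D) :
    (∃ S : DVB.LinearSplitting D, g.IsLagrangian S) ∧
    (∀ S : DVB.LinearSplitting D, ∃ Λ : DVB.SmoothTensor EM FQ Q FB B,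
      Λ.IsSymmetric ∧
      (∀ (m : M) (q₁ q₂ : Q m) (b : B m),
        g.pair (S.val q₁ b) (S.val q₂ b) = Λ.toFun m q₁ q₂ b) ∧
      ∃ S' : DVB.LinearSplitting D, g.DifferBy S S' (1 / 2) Λ ∧ g.IsLagrangian S') ∧
    (∀ S₁ S₂ : DVB.LinearSplitting D, g.IsLagrangian S₁ →
      ∃ φ : DVB.SmoothTensor EM FQ Q FB B,
        g.DifferBy S₁ S₂ 1 φ ∧ (g.IsLagrangian S₂ ↔ φ.IsSkew)) := by
  obtain ⟨K, hK⟩ := g.exists_isCorePairing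
  refine ⟨?_, fun S => ?_, fun S₁ S₂ h => ?_⟩
  · obtain ⟨S, -, hS⟩ := g.exists_isLagrangian_differBy hK.splitting
    exact ⟨S, hS⟩
  · exact ⟨g.tensor S S, g.isSymmetric_tensor_self S, fun m q₁ q₂ b => g.pair_val S m q₁ q₂ b,
      g.exists_isLagrangian_differBy S⟩
  · obtain ⟨φ, hφ⟩ := g.exists_differBy S₁ S₂
    exact ⟨φ, hφ, h.isLagrangian_iff_isSkew hφ⟩

theorem proposition3p5
    {EM : Type*} [NormedAddCommGroup EM] [NormedSpace ℝ EM] [FiniteDimensional ℝ EM]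
    {M : Type*} [TopologicalSpace M] [ChartedSpace EM M] [IsManifold 𝓘(ℝ, EM) ∞ M]
    [T2Space M] [SigmaCompactSpace M]
    -- the side bundle `Q → M`
    {FQ : Type*} [NormedAddCommGroup FQ] [NormedSpace ℝ FQ] [FiniteDimensional ℝ FQ]
    {Q : M → Type*} [∀ m, AddCommGroup (Q m)] [∀ m, Module ℝ (Q m)]
    [∀ m, TopologicalSpace (Q m)] [TopologicalSpace (TotalSpace FQ Q)]
    [FiberBundle FQ Q] [VectorBundle ℝ FQ Q] [ContMDiffVectorBundle ∞ FQ Q 𝓘(ℝ, EM)]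
    -- the side bundle `B → M`
    {FB : Type*} [NormedAddCommGroup FB] [NormedSpace ℝ FB] [FiniteDimensional ℝ FB]
    {B : M → Type*} [∀ m, AddCommGroup (B m)] [∀ m, Module ℝ (B m)]
    [∀ m, TopologicalSpace (B m)] [TopologicalSpace (TotalSpace FB B)]
    [FiberBundle FB B] [VectorBundle ℝ FB B] [ContMDiffVectorBundle ∞ FB B 𝓘(ℝ, EM)]
    -- the vector bundle `𝔼 → Q`
    {FEQ : Type*} [NormedAddCommGroup FEQ] [NormedSpace ℝ FEQ] [FiniteDimensional ℝ FEQ]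
    {EQ : TotalSpace FQ Q → Type*} [∀ q, AddCommGroup (EQ q)] [∀ q, Module ℝ (EQ q)]
    [∀ q, TopologicalSpace (EQ q)] [TopologicalSpace (TotalSpace FEQ EQ)]
    [FiberBundle FEQ EQ] [VectorBundle ℝ FEQ EQ]
    [ContMDiffVectorBundle ∞ FEQ EQ (𝓘(ℝ, EM).prod 𝓘(ℝ, FQ))]
    -- the vector bundle `𝔼 → B`
    {FEB : Type*} [NormedAddCommGroup FEB] [NormedSpace ℝ FEB] [FiniteDimensional ℝ FEB]
    {EB : TotalSpace FB B → Type*} [∀ b, AddCommGroup (EB b)] [∀ b, Module ℝ (EB b)]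
    [∀ b, TopologicalSpace (EB b)] [TopologicalSpace (TotalSpace FEB EB)]
    [FiberBundle FEB EB] [VectorBundle ℝ FEB EB]
    [ContMDiffVectorBundle ∞ FEB EB (𝓘(ℝ, EM).prod 𝓘(ℝ, FB))]
    -- the double vector bundle and its linear metric
    (D : DVB.DoubleVectorBundle EM FQ Q FB B FEQ EQ FEB EB) (g : DVB.LinearMetric D) :
    (∃ S : DVB.LinearSplitting D, g.IsLagrangian S) ∧
    (∀ S : DVB.LinearSplitting D, ∃ Λ : DVB.SmoothTensor EM FQ Q FB B,
      Λ.IsSymmetric ∧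
      (∀ (m : M) (q₁ q₂ : Q m) (b : B m),
        g.pair (S.val q₁ b) (S.val q₂ b) = Λ.toFun m q₁ q₂ b) ∧
      ∃ S' : DVB.LinearSplitting D, g.DifferBy S S' (1 / 2) Λ ∧ g.IsLagrangian S') ∧
    (∀ S₁ S₂ : DVB.LinearSplitting D, g.IsLagrangian S₁ →
      ∃ φ : DVB.SmoothTensor EM FQ Q FB B,
        g.DifferBy S₁ S₂ 1 φ ∧ (g.IsLagrangian S₂ ↔ φ.IsSkew)) :=
  proposition3p5_general D g
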